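/- Let $\mathcal{C}at$ be the 2-category of small categories and $\mathcal{CAT}$ the 2-category of not necessarily small categories. Write $\mathbb{1}$ for the terminal category and $[1]$ for the poset $\{0<1\}$, viewed as a category. A prederivator is a strict 2-functor $\mathscr{D}\colon \mathcal{C}at^{\mathrm{op}}\to\mathcal{CAT}$ (the dual reverses functors, not natural transformations); morphisms of prederivators are pseudo-natural transformations and 2-morphisms are modifications. For $u\colon A\to B$ write $u^*\colon\mathscr{D}(B)\to\mathscr{D}(A)$ for the induced functor, and for $a\in A$ write $a^*\colon\mathscr{D}(A)\to\mathscr{D}(\mathbb{1})$ for the functor induced by $a\colon\mathbb 1\to A$. A prederivator $\mathscr{D}$ is a derivator if (Der1) for every set-indexed family $(A_i)$ of small categories the functor $\mathscr{D}(\coprod_i A_i)\to\prod_i\mathscr{D}(A_i)$ is an equivalence; (Der2) a morphism $f$ in $\mathscr{D}(A)$ is an isomorphism if and only if $a^*f$ is one for all $a\in A$; (Der3) every $u^*$ has a left adjoint $u_!$ and a right adjoint $u_*$; (Der4) for all $u\colon A\to B$ and $b\in B$, with $p\colon u/b\to A$, $q\colon b/u\to A$ the projections from the slice categories and $\pi$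 the functors to $\mathbb 1$, the canonical transformations $\pi_!p^*\to b^*u_!$ and $b^*u_*\to\pi_*q^*$ are isomorphisms. Let $\square=[1]\times[1]$ be the commutative square. An object of $\mathscr{D}(\square)$ is cocartesian (resp. cartesian) if it lies in the essential image of the left (resp. right) Kan extension along the inclusion of the full subcategory $\square\setminus\{(1,1)\}$ (resp. $\square\setminus\{(0,0)\}$). A derivator $\mathscr{D}$ is stable if $\mathscr{D}(\mathbb 1)$ has a zero object and an object of $\mathscr{D}(\square)$ is cocartesian if and only if it is cartesian; such squares are then called bicartesian. A morphism of stable derivators is exact if it preserves zero objects and bicartesian squares. Let $\mathcal{DER}$ be the 2-category of derivators (the full sub-2-category of prederivators on the derivators), and $\mathcal{DER}_{\mathrm{St},\mathrm{ex}}$ its sub-2-category of stable derivators, exact morphisms and all 2-morphisms between these. For a small category $A$, let $\mathscr{D}^A$ be the derivator $\mathscr{D}^A(B)=\mathscr{D}(A\times B)$; this defines a 2-functor $(-)^A\colon\mathcal{DER}_{\mathrm{St},\mathrm{ex}}\to\mathcal{DER}$. Small categories $A$ and $A'$ are strongly stably equivalent if there is a pseudo-natural equivalence $\Phi\colon(-)^A\simeq(-)^{A'}$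 between these 2-functors, i.e. a pseudo-natural transformation all of whose components $\Phi_{\mathscr{D}}\colon\mathscr{D}^A\to\mathscr{D}^{A'}$ are equivalences in $\mathcal{DER}$. Let the trivalent source be the full subcategory $[1]^3_{\le 1}$ of the cube $[1]^3$ on the vertices with at most one coordinate equal to $1$ (the quiver with three arrows out of one vertex), and let the trivalent sink be the full subcategory $[1]^3_{\ge 2}$ on the vertices with at least two coordinates equal to $1$ (the quiver with three arrows into one vertex). Theorem. The trivalent source, the trivalent sink and the commutative square $\square$ are pairwise strongly stably equivalent. -/

import Mathlib

universe w v u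

namespace AbstractTilting

open CategoryTheory Bicategory Bicategory.Opposite Opposite Limits
open scoped CategoryTheory.Pseudofunctor.StrongTrans

/-! ### Prederivators

`Cat.{w, w}` is the 2-category of small categories, `Cat.{v, u}` the 2-category of categories of an
arbitrary size, and `Cat.{w, w}ᵒᵖ` is the 1-cell dual (it reverses functors but not natural
transformations). -/

/-- A prederivator is a (strict) 2-functor `Catᵒᵖ ⥤ CAT`. -/
abbrev Prederivator : Type _ := StrictPseudofunctor (Cat.{w, w})ᵒᵖ Cat.{v, u}

namespace Prederivator

/-- The category `D(A)` of coherent diagrams of shape `A`. -/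
abbrev Diag (D : Prederivator.{w, v, u}) (A : Cat.{w, w}) : Cat.{v, u} := D.obj (op A)

/-- The restriction functor `f^* : D(B) ⥤ D(A)` along `f : A ⥤ B`. -/
abbrev res (D : Prederivator.{w, v, u}) {A B : Cat.{w, w}} (f : A ⟶ B) : D.Diag B ⥤ D.Diag A :=
  (D.map f.op).toFunctor

/-- The natural transformation `α^* : f^* ⟶ g^*` induced by `α : f ⟶ g`. -/
abbrev resMap (D : Prederivator.{w, v, u}) {A B : Cat.{w, w}} {f g : A ⟶ B} (α : f ⟶ g) :
    D.res f ⟶ D.res g :=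
  (D.map₂ (op2 α)).toNatTrans

/-- The strict functoriality `(f ≫ g)^* = f^* ∘ g^*`, as an isomorphism. -/
abbrev resComp (D : Prederivator.{w, v, u}) {A B C : Cat.{w, w}} (f : A ⟶ B) (g : B ⟶ C) :
    D.res (f ≫ g) ≅ D.res g ⋙ D.res f :=
  Cat.Hom.toNatIso (D.mapComp g.op f.op)

/-- The transformation `p^* f^* ⟶ q^* g^*` induced by a natural transformation `f ∘ p ⟶ g ∘ q`. -/
def square (D : Prederivator.{w, v, u}) {S A B C : Cat.{w, w}} {p : S ⟶ A} {f : A ⟶ C}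
    {q : S ⟶ B} {g : B ⟶ C} (α : p ≫ f ⟶ q ≫ g) :
    D.res f ⋙ D.res p ⟶ D.res g ⋙ D.res q :=
  (D.resComp p f).inv ≫ D.resMap α ≫ (D.resComp q g).hom

end Prederivator

/-- The terminal category. -/
abbrev pt : Cat.{w, w} := Cat.of (Discrete PUnit.{w + 1})

/-- The functor from the terminal category that picks the object `a`. -/
abbrev pick {A : Cat.{w, w}} (a : A) : pt.{w} ⟶ A := (Functor.fromPUnit.{w} (a : A)).toCatHom

/-! ### The slice categories `f / b` and `b / f` -/

section Slices

variable {A B : Cat.{w, w}} (f : A ⟶ B) (b : B)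

/-- The slice category `f / b`: objects are pairs `(a, f a ⟶ b)`. -/
abbrev overSlice : Cat.{w, w} := Cat.of (Comma f.toFunctor (Functor.fromPUnit.{w} b))

/-- The projection `f / b ⥤ A`. -/
abbrev overProj : overSlice f b ⟶ A := Functor.toCatHom (D := A) (Comma.fst _ _)

/-- The functor from `f / b` to the terminal category. -/
abbrev overPi : overSlice f b ⟶ pt.{w} := (Comma.snd _ _).toCatHom

/-- The canonical transformation `f ∘ p ⟶ b ∘ π` on `f / b`. -/
abbrev overTrans : overProj f b ≫ f ⟶ overPi f b ≫ pick b :=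
  Cat.Hom₂.ofNatTrans (Comma.natTrans f.toFunctor (Functor.fromPUnit.{w} b))

/-- The slice category `b / f`: objects are pairs `(a, b ⟶ f a)`. -/
abbrev underSlice : Cat.{w, w} := Cat.of (Comma (Functor.fromPUnit.{w} b) f.toFunctor)

/-- The projection `b / f ⥤ A`. -/
abbrev underProj : underSlice f b ⟶ A := Functor.toCatHom (D := A) (Comma.snd _ _)

/-- The functor from `b / f` to the terminal category. -/
abbrev underPi : underSlice f b ⟶ pt.{w} := (Comma.fst _ _).toCatHom

/-- The canonical transformation `b ∘ π ⟶ f ∘ q` on `b / f`. -/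
abbrev underTrans : underPi f b ≫ pick b ⟶ underProj f b ≫ f :=
  Cat.Hom₂.ofNatTrans (Comma.natTrans (Functor.fromPUnit.{w} b) f.toFunctor)

end Slices

/-! ### Derivators -/

/-- The comparison functor `D(∐ Aᵢ) ⥤ ∏ D(Aᵢ)` given by restriction to the summands. -/
abbrev coprodComparison (D : Prederivator.{w, v, u}) {I : Type w} (A : I → Cat.{w, w}) :
    D.Diag (Cat.of (Σ i, A i)) ⥤ ∀ i, D.Diag (A i) :=
  Functor.pi' fun i => D.res (Functor.toCatHom (C := A i) (Sigma.incl (C := fun i => A i) i))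

/-- The axioms of a derivator. Adjoints being unique up to unique isomorphism, (Der4) does not
depend on which adjoints are used; it is stated for all of them. -/
structure IsDerivator (D : Prederivator.{w, v, u}) : Prop where
  /-- (Der1) `D` takes coproducts to products. -/
  der1 {I : Type w} (A : I → Cat.{w, w}) : (coprodComparison D A).IsEquivalence
  /-- (Der2) Isomorphisms are detected pointwise. -/
  der2 {A : Cat.{w, w}} {X Y : D.Diag A} (φ : X ⟶ Y) :
    IsIso φ ↔ ∀ a : A, IsIso ((D.res (pick a)).map φ)
  /-- (Der3) Left Kan extensions `f_!` exist. -/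
  der3_left {A B : Cat.{w, w}} (f : A ⟶ B) : (D.res f).IsRightAdjoint
  /-- (Der3) Right Kan extensions `f_*` exist. -/
  der3_right {A B : Cat.{w, w}} (f : A ⟶ B) : (D.res f).IsLeftAdjoint
  /-- (Der4) The canonical transformation `π_! p^* ⟶ b^* f_!` is an isomorphism. -/
  der4_left {A B : Cat.{w, w}} (f : A ⟶ B) (b : B)
    {lan : D.Diag A ⥤ D.Diag B} (adj : lan ⊣ D.res f)
    {colim : D.Diag (overSlice f b) ⥤ D.Diag pt.{w}} (adj' : colim ⊣ D.res (overPi f b)) :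
    IsIso ((CategoryTheory.mateEquiv adj adj').symm
      (TwoSquare.mk _ _ _ _ (D.square (overTrans f b)))).natTrans
  /-- (Der4) The canonical transformation `b^* f_* ⟶ π_* q^*` is an isomorphism. -/
  der4_right {A B : Cat.{w, w}} (f : A ⟶ B) (b : B)
    {ran : D.Diag A ⥤ D.Diag B} (adj : D.res f ⊣ ran)
    {lim : D.Diag (underSlice f b) ⥤ D.Diag pt.{w}} (adj' : D.res (underPi f b) ⊣ lim) :
    IsIso (CategoryTheory.mateEquiv adj adj'
      (TwoSquare.mk _ _ _ _ (D.square (underTrans f b)))).natTrans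

/-! ### Stable derivators -/

/-- The commutative square `[1] × [1]`. A preorder is a category with at most one morphism between
any two objects. -/
abbrev commSquare : Cat.{w, w} := Cat.of (ULift.{w} (Fin 2 × Fin 2))

/-- The full subcategory of the square on the objects other than `(1, 1)`. -/
abbrev ulCorner : Cat.{w, w} := Cat.of {x : ULift.{w} (Fin 2 × Fin 2) // x.down ≠ (1, 1)}

/-- The full subcategory of the square on the objects other than `(0, 0)`. -/
abbrev lrCorner : Cat.{w, w} := Cat.of {x : ULift.{w} (Fin 2 × Fin 2) // x.down ≠ (0, 0)}

/-- The inclusion of the upper left corner into the square. -/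
abbrev ulIncl : ulCorner.{w} ⟶ commSquare.{w} :=
  Functor.toCatHom (Monotone.functor (f := Subtype.val) fun _ _ h => h)

/-- The inclusion of the lower right corner into the square. -/
abbrev lrIncl : lrCorner.{w} ⟶ commSquare.{w} :=
  Functor.toCatHom (Monotone.functor (f := Subtype.val) fun _ _ h => h)

/-- A coherent square is cocartesian if it lies in the essential image of the left Kan extension
along the inclusion of the upper left corner. -/
def IsCocartesian (D : Prederivator.{w, v, u}) (X : D.Diag commSquare.{w}) : Prop :=
  ∃ (lan : D.Diag ulCorner.{w} ⥤ D.Diag commSquare.{w}) (_ : lan ⊣ D.res ulIncl), lan.essImage X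

/-- A coherent square is cartesian if it lies in the essential image of the right Kan extension
along the inclusion of the lower right corner. -/
def IsCartesian (D : Prederivator.{w, v, u}) (X : D.Diag commSquare.{w}) : Prop :=
  ∃ (ran : D.Diag lrCorner.{w} ⥤ D.Diag commSquare.{w}) (_ : D.res lrIncl ⊣ ran), ran.essImage X

/-- A stable derivator: a derivator that is pointed (its underlying category has a zero object), and
for which cocartesian and cartesian squares coincide. -/
structure IsStableDerivator (D : Prederivator.{w, v, u}) : Prop extends IsDerivator D where
  pointed : HasZeroObject (D.Diag pt.{w})
  cocartesian_iff_cartesian (X : D.Diag commSquare.{w}) : IsCocartesian D X ↔ IsCartesian D X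

/-! ### The 2-category of prederivators -/

/-- The 2-category of prederivators, pseudo-natural transformations and modifications. It contains
the 2-category of derivators as the full sub-2-category on the derivators. -/
abbrev PDer : Type _ :=
  InducedBicategory (Pseudofunctor (Cat.{w, w})ᵒᵖ Cat.{v, u})
    fun D : Prederivator.{w, v, u} => D.toPseudofunctor

/-- The functor `F_A : D(A) ⥤ E(A)` of a morphism of prederivators `F : D ⟶ E`. -/
abbrev component {D E : PDer.{w, v, u}} (F : D ⟶ E) (A : Cat.{w, w}) :
    Prederivator.Diag D A ⥤ Prederivator.Diag E A :=
  (F.hom.app (op A)).toFunctor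

/-- A morphism between stable derivators is exact if it preserves zero objects and
bicartesian squares. -/
structure IsExact {D E : PDer.{w, v, u}} (F : D ⟶ E) : Prop where
  map_zero (X : Prederivator.Diag D pt.{w}) : IsZero X → IsZero ((component F pt).obj X)
  map_bicartesian (X : Prederivator.Diag D commSquare.{w}) :
    IsCocartesian D X ∧ IsCartesian D X →
      IsCocartesian E ((component F commSquare).obj X) ∧
        IsCartesian E ((component F commSquare).obj X)

theorem IsExact.id (D : PDer.{w, v, u}) : IsExact (𝟙 D) where
  map_zero _ h := h
  map_bicartesian _ h := h

theorem IsExact.comp {D E K : PDer.{w, v, u}} {F : D ⟶ E} {G : E ⟶ K} (hF : IsExact F)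
    (hG : IsExact G) : IsExact (F ≫ G) where
  map_zero X h := hG.map_zero _ (hF.map_zero X h)
  map_bicartesian X h := hG.map_bicartesian _ (hF.map_bicartesian X h)

/-! ### The 2-category of stable derivators, exact morphisms and arbitrary transformations -/

/-- The objects: stable derivators. -/
structure StDer : Type _ where
  toPDer : PDer.{w, v, u}
  stable : IsStableDerivator toPDer

namespace StDer

/-- The 1-morphisms: exact morphisms. -/
@[ext]
structure Hom (D E : StDer.{w, v, u}) where
  hom : D.toPDer ⟶ E.toPDer
  exact : IsExact hom

instance : CategoryStruct StDer.{w, v, u} where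
  Hom D E := Hom D E
  id D := ⟨𝟙 D.toPDer, IsExact.id _⟩
  comp F G := ⟨F.hom ≫ G.hom, F.exact.comp G.exact⟩

@[simp]
theorem id_hom (D : StDer.{w, v, u}) : Hom.hom (𝟙 D) = 𝟙 D.toPDer := rfl

@[simp]
theorem comp_hom {D E K : StDer.{w, v, u}} (F : D ⟶ E) (G : E ⟶ K) :
    Hom.hom (F ≫ G) = Hom.hom F ≫ Hom.hom G := rfl

/-- The 2-morphisms: all transformations (modifications). -/
@[ext]
structure Hom₂ {D E : StDer.{w, v, u}} (F G : D ⟶ E) where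
  hom : Hom.hom F ⟶ Hom.hom G

instance homCategory (D E : StDer.{w, v, u}) : Category (D ⟶ E) where
  Hom F G := Hom₂ F G
  id F := ⟨𝟙 (Hom.hom F)⟩
  comp α β := ⟨α.hom ≫ β.hom⟩

@[simp]
theorem id₂_hom {D E : StDer.{w, v, u}} (F : D ⟶ E) : Hom₂.hom (𝟙 F) = 𝟙 (Hom.hom F) := rfl

@[simp]
theorem comp₂_hom {D E : StDer.{w, v, u}} {F G H : D ⟶ E} (α : F ⟶ G) (β : G ⟶ H) :
    Hom₂.hom (α ≫ β) = Hom₂.hom α ≫ Hom₂.hom β := rfl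

@[ext]
theorem hom₂_ext {D E : StDer.{w, v, u}} {F G : D ⟶ E} {α β : F ⟶ G}
    (h : Hom₂.hom α = Hom₂.hom β) : α = β :=
  Hom₂.ext h

/-- An isomorphism of the underlying morphisms is an isomorphism of exact morphisms. -/
@[simps]
def isoMk {D E : StDer.{w, v, u}} {F G : D ⟶ E} (e : Hom.hom F ≅ Hom.hom G) : F ≅ G where
  hom := Hom₂.mk e.hom
  inv := Hom₂.mk e.inv
  hom_inv_id := by ext1; exact e.hom_inv_id
  inv_hom_id := by ext1; exact e.inv_hom_id

instance bicategory : Bicategory StDer.{w, v, u} where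
  homCategory := homCategory
  whiskerLeft F _ _ α := Hom₂.mk (Hom.hom F ◁ Hom₂.hom α)
  whiskerRight α G := Hom₂.mk (Hom₂.hom α ▷ Hom.hom G)
  associator F G H := isoMk (α_ (Hom.hom F) (Hom.hom G) (Hom.hom H))
  leftUnitor F := isoMk (λ_ (Hom.hom F))
  rightUnitor F := isoMk (ρ_ (Hom.hom F))
  whiskerLeft_id _ _ := by ext1; exact whiskerLeft_id _ _
  whiskerLeft_comp _ _ _ _ _ _ := by ext1; exact whiskerLeft_comp _ _ _
  id_whiskerLeft _ := by ext1; exact id_whiskerLeft _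
  comp_whiskerLeft _ _ _ _ _ := by ext1; exact comp_whiskerLeft _ _ _
  id_whiskerRight _ _ := by ext1; exact id_whiskerRight _ _
  comp_whiskerRight _ _ _ := by ext1; exact comp_whiskerRight _ _ _
  whiskerRight_id _ := by ext1; exact whiskerRight_id _
  whiskerRight_comp _ _ _ := by ext1; exact whiskerRight_comp _ _ _
  whisker_assoc _ _ _ _ _ := by ext1; exact whisker_assoc _ _ _
  whisker_exchange _ _ := by ext1; exact whisker_exchange _ _
  pentagon _ _ _ _ := by ext1; exact pentagon _ _ _ _
  triangle _ _ := by ext1; exact triangle _ _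

end StDer

/-! ### Precomposition with a pseudofunctor -/

section Precomposition

universe w₁ w₂ w₃ v₁ v₂ v₃ u₁ u₂ u₃

variable {B : Type u₁} [Bicategory.{w₁, v₁} B] {C : Type u₂} [Bicategory.{w₂, v₂} C]
  {K : Type u₃} [Bicategory.{w₃, v₃} K]

theorem associator_aux {a b c d : K} (f : a ⟶ b) (g : b ⟶ c) (h : c ⟶ d) :
    (α_ f g h).hom = 𝟙 _ ≫ 𝟙 (f ≫ g) ▷ h ≫ (α_ f g h).hom ≫ f ◁ 𝟙 (g ≫ h) ≫ 𝟙 _ := by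
  simp

theorem leftUnitor_aux {a b : K} (f : a ⟶ b) :
    (λ_ f).hom = 𝟙 _ ≫ 𝟙 (𝟙 a) ▷ f ≫ (λ_ f).hom := by
  simp

theorem rightUnitor_aux {a b : K} (f : a ⟶ b) :
    (ρ_ f).hom = 𝟙 _ ≫ f ◁ 𝟙 (𝟙 b) ≫ (ρ_ f).hom := by
  simp

/-- Precomposition of a pseudo-natural transformation with a pseudofunctor. -/
@[simps]
def precompTrans (P : Pseudofunctor B C) {F G : Pseudofunctor C K} (η : F ⟶ G) :
    Pseudofunctor.StrongTrans (P.comp F) (P.comp G) where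
  app b := η.app (P.obj b)
  naturality f := η.naturality (P.map f)
  naturality_naturality α := η.naturality_naturality (P.map₂ α)
  naturality_id b := by
    have h : (η.naturality (P.map (𝟙 b))).hom ≫
        η.app (P.obj b) ◁ (G.map₂ (P.mapId b).hom ≫ (G.mapId (P.obj b)).hom) =
      (F.map₂ (P.mapId b).hom ≫ (F.mapId (P.obj b)).hom) ▷ η.app (P.obj b) ≫
        (λ_ (η.app (P.obj b))).hom ≫ (ρ_ (η.app (P.obj b))).inv := by
      rw [whiskerLeft_comp, comp_whiskerRight, Category.assoc, ← η.naturality_id,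
        η.naturality_naturality_assoc]
    exact h
  naturality_comp {a b c} f g := by
    have h : (η.naturality (P.map (f ≫ g))).hom ≫
        η.app (P.obj a) ◁ (G.map₂ (P.mapComp f g).hom ≫ (G.mapComp (P.map f) (P.map g)).hom) =
      (F.map₂ (P.mapComp f g).hom ≫ (F.mapComp (P.map f) (P.map g)).hom) ▷ η.app (P.obj c) ≫
        (α_ _ _ _).hom ≫ F.map (P.map f) ◁ (η.naturality (P.map g)).hom ≫ (α_ _ _ _).inv ≫
          (η.naturality (P.map f)).hom ▷ G.map (P.map g) ≫ (α_ _ _ _).hom := by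
      rw [whiskerLeft_comp, comp_whiskerRight, Category.assoc, ← η.naturality_comp,
        η.naturality_naturality_assoc]
    exact h

/-- Precomposition of a modification with a pseudofunctor. -/
@[simps]
def precompMod (P : Pseudofunctor B C) {F G : Pseudofunctor C K} {η θ : F ⟶ G} (Γ : η ⟶ θ) :
    Pseudofunctor.StrongTrans.Modification (precompTrans P η) (precompTrans P θ) where
  app b := Γ.as.app (P.obj b)
  naturality f := Γ.as.naturality (P.map f)

/-- Precomposition with a pseudofunctor, as a 2-functor. -/
@[simps]
def precomp (P : Pseudofunctor B C) :
    Pseudofunctor (Pseudofunctor C K) (Pseudofunctor B K) where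
  obj F := P.comp F
  map η := precompTrans P η
  map₂ Γ := Pseudofunctor.StrongTrans.Hom.of (precompMod P Γ)
  map₂_id _ := rfl
  map₂_comp _ _ := rfl
  mapId F := Pseudofunctor.StrongTrans.isoMk (fun b => Iso.refl _) (fun f => by
    refine (congrArg (· ≫ _) (whiskerLeft_id _ _)).trans ?_
    refine Eq.trans ?_ (congrArg (_ ≫ ·) (id_whiskerRight _ _).symm)
    exact (Category.id_comp _).trans (Category.comp_id _).symm)
  mapComp η θ := Pseudofunctor.StrongTrans.isoMk (fun b => Iso.refl _) (fun f => by
    refine (congrArg (· ≫ _) (whiskerLeft_id _ _)).trans ?_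
    refine Eq.trans ?_ (congrArg (_ ≫ ·) (id_whiskerRight _ _).symm)
    exact (Category.id_comp _).trans (Category.comp_id _).symm)
  map₂_whisker_left η _ _ Γ := by
    ext b
    exact ((Category.id_comp _).trans (Category.comp_id _)).symm
  map₂_whisker_right Γ η := by
    ext b
    exact ((Category.id_comp _).trans (Category.comp_id _)).symm
  map₂_associator η θ ι := by
    ext b
    exact associator_aux _ _ _
  map₂_left_unitor η := by
    ext b
    exact leftUnitor_aux _
  map₂_right_unitor η := by
    ext b
    exact rightUnitor_aux _

end Precomposition

/-! ### Shifted derivators -/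

/-- The functor `A × B ⥤ A × C` induced by a functor `B ⥤ C`. -/
abbrev prodMap (A : Cat.{w, w}) {B C : Cat.{w, w}} (f : B ⟶ C) :
    Cat.of (A × B) ⟶ Cat.of (A × C) :=
  ((𝟭 A).prod f.toFunctor).toCatHom

theorem id₃ {T : Type w} [Category.{w} T] (x : T) : 𝟙 x ≫ 𝟙 x ≫ 𝟙 x = 𝟙 x := by simp

theorem id₅ {T : Type w} [Category.{w} T] (x : T) : 𝟙 x ≫ 𝟙 x ≫ 𝟙 x ≫ 𝟙 x ≫ 𝟙 x = 𝟙 x := by simp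

theorem catOp_hom₂_ext {A B : (Cat.{w, w})ᵒᵖ} {f g : A ⟶ B} {α β : f ⟶ g}
    (h : ∀ X, (Hom2.unop2 α).toNatTrans.app X = (Hom2.unop2 β).toNatTrans.app X) : α = β := by
  obtain ⟨⟨α⟩⟩ := α
  obtain ⟨⟨β⟩⟩ := β
  obtain rfl : α = β := NatTrans.ext (funext h)
  rfl

/-- The strict 2-functor `B ↦ A × B`, on the 1-cell dual of the 2-category of small categories. -/
def prodLeft (A : Cat.{w, w}) : StrictPseudofunctor (Cat.{w, w})ᵒᵖ (Cat.{w, w})ᵒᵖ where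
  obj B := op (Cat.of (A × B.unop))
  map f := (prodMap A f.unop).op
  map₂ α := op2 (Cat.Hom₂.ofNatTrans (NatTrans.prod (𝟙 (𝟭 A)) (Hom2.unop2 α).toNatTrans))
  map₂_id f := by
    apply catOp_hom₂_ext
    intro X
    rfl
  map₂_comp α β := by
    apply catOp_hom₂_ext
    intro X
    exact Prod.ext (Category.id_comp _).symm rfl
  map_id B := rfl
  map_comp f g := rfl
  mapId B := Iso.refl _
  mapComp f g := Iso.refl _
  mapId_eq_eqToIso B := rfl
  mapComp_eq_eqToIso f g := rfl
  map₂_whisker_left f g h α := by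
    apply catOp_hom₂_ext
    intro X
    refine Prod.ext ?_ ?_
    · symm; exact (Category.id_comp _).trans (Category.comp_id _)
    · symm; exact (Category.id_comp _).trans (Category.comp_id _)
  map₂_whisker_right α h := by
    apply catOp_hom₂_ext
    intro X
    refine Prod.ext ?_ ?_
    · symm; exact (Category.id_comp _).trans (Category.comp_id _)
    · symm; exact (Category.id_comp _).trans (Category.comp_id _)
  map₂_associator f g h := by
    apply catOp_hom₂_ext
    intro X
    refine Prod.ext ?_ ?_
    · exact (id₅ _).symm
    · refine Eq.trans (id₅ _).symm ?_
      congr 4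
      exact (f.unop.toFunctor.map_id _).symm
  map₂_left_unitor f := by
    apply catOp_hom₂_ext
    intro X
    refine Prod.ext ?_ ?_
    · exact (id₃ _).symm
    · refine Eq.trans (id₃ _).symm ?_
      congr 2
      try exact (f.unop.toFunctor.map_id _).symm
  map₂_right_unitor f := by
    apply catOp_hom₂_ext
    intro X
    refine Prod.ext ?_ ?_
    · exact (id₃ _).symm
    · refine Eq.trans (id₃ _).symm ?_
      congr 2
      try exact (f.unop.toFunctor.map_id _).symm

/-- The shifted prederivator `D^A`, given by `D^A(B) = D(A × B)`. -/
def shift (A : Cat.{w, w}) (D : PDer.{w, v, u}) : PDer.{w, v, u} :=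
  StrictPseudofunctor.comp (prodLeft A) D

/-- The morphism `F^A : D^A ⟶ E^A` induced by `F : D ⟶ E`, with components `F_{A × B}`. -/
def shiftHom (A : Cat.{w, w}) {D E : PDer.{w, v, u}} (F : D ⟶ E) : shift A D ⟶ shift A E :=
  InducedBicategory.mkHom ((precomp (prodLeft A).toPseudofunctor).map F.hom)

/-- The transformation `F^A ⟶ G^A` induced by `α : F ⟶ G`, with components `α_{A × B}`. -/
def shiftHom₂ (A : Cat.{w, w}) {D E : PDer.{w, v, u}} {F G : D ⟶ E} (α : F ⟶ G) :
    shiftHom A F ⟶ shiftHom A G :=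
  InducedBicategory.Hom₂.mk ((precomp (prodLeft A).toPseudofunctor).map₂ α.hom)

/-- The 2-functor `D ↦ D^A` on the 2-category of stable derivators and exact morphisms. Its values
are derivators, which form a full sub-2-category of prederivators; so pseudo-natural transformations
between such 2-functors, and equivalences between their values, are the same in both. -/
def shiftFunctor (A : Cat.{w, w}) : Pseudofunctor StDer.{w, v, u} PDer.{w, v, u} where
  obj D := shift A D.toPDer
  map F := shiftHom A (StDer.Hom.hom F)
  map₂ α := shiftHom₂ A (StDer.Hom₂.hom α)
  map₂_id _ := rfl
  map₂_comp _ _ := rfl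
  mapId _ := InducedBicategory.isoMk ((precomp (prodLeft A).toPseudofunctor).mapId _)
  mapComp _ _ := InducedBicategory.isoMk ((precomp (prodLeft A).toPseudofunctor).mapComp _ _)
  map₂_whisker_left _ _ _ α := InducedBicategory.hom₂_ext
    ((precomp (prodLeft A).toPseudofunctor).map₂_whisker_left _ (StDer.Hom₂.hom α).hom)
  map₂_whisker_right α _ := InducedBicategory.hom₂_ext
    ((precomp (prodLeft A).toPseudofunctor).map₂_whisker_right (StDer.Hom₂.hom α).hom _)
  map₂_associator _ _ _ := InducedBicategory.hom₂_ext
    ((precomp (prodLeft A).toPseudofunctor).map₂_associator _ _ _)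
  map₂_left_unitor _ := InducedBicategory.hom₂_ext
    ((precomp (prodLeft A).toPseudofunctor).map₂_left_unitor _)
  map₂_right_unitor _ := InducedBicategory.hom₂_ext
    ((precomp (prodLeft A).toPseudofunctor).map₂_right_unitor _)

/-- A strong stable equivalence between the small categories `A` and `A'`: a pseudo-natural
transformation `Φ` from `D ↦ D^A` to `D ↦ D^A'`, such that every component `Φ_D : D^A ⟶ D^A'` is
an equivalence internal to the 2-category of derivators. -/
structure StrongStableEquivalence (A A' : Cat.{w, w}) where
  toTrans : Pseudofunctor.StrongTrans (shiftFunctor.{w, v, u} A) (shiftFunctor.{w, v, u} A')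
  isEquivalence (D : StDer.{w, v, u}) :
    ∃ e : Bicategory.Equivalence (shift A D.toPDer) (shift A' D.toPDer),
      e.hom = toTrans.app D

/-- Two small categories are strongly stably equivalent if there is a strong stable equivalence
between them. -/
def StronglyStablyEquivalent (A A' : Cat.{w, w}) : Prop :=
  Nonempty (StrongStableEquivalence.{w, v, u} A A')

/-! ### The trivalent source and sink -/

/-- The source of valence three (three arrows out of one vertex), as the full subcategory of the cube `[1]³` on the vertices with at
most one coordinate equal to `1`. -/
abbrev trivalentSource : Cat.{w, w} :=
  Cat.of {x : ULift.{w} (Fin 3 → Fin 2) // ∑ i, (x.down i : ℕ) ≤ 1}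

/-- The sink of valence three (three arrows into one vertex), as the full subcategory of the cube `[1]³` on the vertices with at
least two coordinates equal to `1`. -/
abbrev trivalentSink : Cat.{w, w} :=
  Cat.of {x : ULift.{w} (Fin 3 → Fin 2) // 2 ≤ ∑ i, (x.down i : ℕ)}

end AbstractTilting

namespace AbstractTilting

open CategoryTheory Bicategory Bicategory.Opposite Opposite Limits
open scoped CategoryTheory.Pseudofunctor.StrongTrans

/-! ### Universal arrows -/

section Universal

universe v₁ v₂ u₁ u₂

variable {C : Type u₁} [Category.{v₁} C] {E : Type u₂} [Category.{v₂} E]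

/-- The arrow `φ : d ⟶ R c` is universal from `d` to the functor `R`. -/
def IsUniv (R : C ⥤ E) {d : E} {c : C} (φ : d ⟶ R.obj c) : Prop :=
  ∀ Z : C, Function.Bijective fun h : c ⟶ Z => φ ≫ R.map h

/-- The arrow `φ : R c ⟶ d` is universal from the functor `R` to `d`. -/
def IsCouniv (R : C ⥤ E) {d : E} {c : C} (φ : R.obj c ⟶ d) : Prop :=
  ∀ Z : C, Function.Bijective fun h : Z ⟶ c => R.map h ≫ φ

theorem bijective_comp_right {c d d' : C} (e : d ⟶ d') [IsIso e] :
    Function.Bijective fun h : c ⟶ d => h ≫ e :=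
  ⟨fun _ _ h => (cancel_mono e).1 h, fun h => ⟨h ≫ inv e, by simp⟩⟩

theorem bijective_comp_left {c c' d : C} (e : c' ⟶ c) [IsIso e] :
    Function.Bijective fun h : c ⟶ d => e ≫ h :=
  ⟨fun _ _ h => (cancel_epi e).1 h, fun h => ⟨inv e ≫ h, by simp⟩⟩

theorem isIso_of_bijective_comp_left {c c' : C} (e : c' ⟶ c)
    (h : ∀ Z : C, Function.Bijective fun f : c ⟶ Z => e ≫ f) : IsIso e := by
  obtain ⟨f, hf⟩ := (h c').2 (𝟙 _)
  refine ⟨f, hf, (h c).1 ?_⟩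
  change e ≫ f ≫ e = e ≫ 𝟙 c
  rw [reassoc_of% (show e ≫ f = 𝟙 c' from hf), Category.comp_id]

theorem isIso_of_bijective_comp_right {c c' : C} (e : c ⟶ c')
    (h : ∀ Z : C, Function.Bijective fun f : Z ⟶ c => f ≫ e) : IsIso e := by
  obtain ⟨f, hf⟩ := (h c').2 (𝟙 _)
  have hf : f ≫ e = 𝟙 c' := hf
  refine ⟨f, (h c).1 ?_, hf⟩
  change (e ≫ f) ≫ e = 𝟙 c ≫ e
  rw [Category.assoc, hf, Category.comp_id, Category.id_comp]

variable {R : C ⥤ E} {d d' : E} {c c' : C}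

/-- The bijection of `φ ≫ R.map e` is that of `φ` after precomposition with `e`, and Yoneda
concludes. This translates the invertibility of a mate in (Der4) into universality of an arrow. -/
theorem isUniv_comp_map_iff {φ : d ⟶ R.obj c} (hφ : IsUniv R φ) (e : c ⟶ c') :
    IsUniv R (φ ≫ R.map e) ↔ IsIso e := by
  have key : ∀ Z : C, (fun h : c' ⟶ Z => (φ ≫ R.map e) ≫ R.map h) =
      (fun h : c ⟶ Z => φ ≫ R.map h) ∘ fun h : c' ⟶ Z => e ≫ h := by
    intro Z
    funext h
    simp
  constructor
  · intro h
    refine isIso_of_bijective_comp_left e fun Z => ?_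
    have := h Z
    rw [key Z] at this
    exact ((hφ Z).of_comp_iff' _).1 this
  · intro _ Z
    rw [key Z]
    exact (hφ Z).comp (bijective_comp_left e)

theorem isCouniv_map_comp_iff {φ : R.obj c ⟶ d} (hφ : IsCouniv R φ) (e : c' ⟶ c) :
    IsCouniv R (R.map e ≫ φ) ↔ IsIso e := by
  have key : ∀ Z : C, (fun h : Z ⟶ c' => R.map h ≫ R.map e ≫ φ) =
      (fun h : Z ⟶ c => R.map h ≫ φ) ∘ fun h : Z ⟶ c' => h ≫ e := by
    intro Z
    funext h
    simp
  constructor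
  · intro h
    refine isIso_of_bijective_comp_right e fun Z => ?_
    have := h Z
    rw [key Z] at this
    exact ((hφ Z).of_comp_iff' _).1 this
  · intro _ Z
    rw [key Z]
    exact (hφ Z).comp (bijective_comp_right e)

/-- Absorbs the coherence isomorphisms `resComp` and `resIso` that accompany every change of
diagram. -/
theorem IsUniv.of_comm {R' : C ⥤ E} (r : R ≅ R') {φ : d ⟶ R.obj c} {φ' : d' ⟶ R'.obj c'}
    (i : d ≅ d') (j : c ≅ c') (h : φ ≫ r.hom.app c ≫ R'.map j.hom = i.hom ≫ φ')
    (hφ : IsUniv R φ) : IsUniv R' φ' := by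
  intro Z
  have key : (fun h : c' ⟶ Z => φ' ≫ R'.map h) =
      (fun x : d ⟶ R'.obj Z => i.inv ≫ x) ∘ (fun x : d ⟶ R.obj Z => x ≫ r.hom.app Z) ∘
        (fun h : c ⟶ Z => φ ≫ R.map h) ∘ fun h : c' ⟶ Z => j.hom ≫ h := by
    funext x
    have h' : φ' = i.inv ≫ φ ≫ r.hom.app c ≫ R'.map j.hom := by rw [h, i.inv_hom_id_assoc]
    simp [h']
  rw [key]
  exact (bijective_comp_left _).comp ((bijective_comp_right _).comp
    ((hφ Z).comp (bijective_comp_left _)))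

theorem IsCouniv.of_comm {R' : C ⥤ E} (r : R ≅ R') {φ : R.obj c ⟶ d} {φ' : R'.obj c' ⟶ d'}
    (i : d ≅ d') (j : c ≅ c') (h : φ ≫ i.hom = r.hom.app c ≫ R'.map j.hom ≫ φ')
    (hφ : IsCouniv R φ) : IsCouniv R' φ' := by
  intro Z
  have key : (fun h : Z ⟶ c' => R'.map h ≫ φ') =
      (fun x : R'.obj Z ⟶ d => x ≫ i.hom) ∘ (fun x : R.obj Z ⟶ d => r.inv.app Z ≫ x) ∘
        (fun h : Z ⟶ c => R.map h ≫ φ) ∘ fun h : Z ⟶ c' => h ≫ j.inv := by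
    funext x
    simp [h]
  rw [key]
  exact (bijective_comp_right _).comp ((bijective_comp_left _).comp
    ((hφ Z).comp (bijective_comp_right _)))

theorem isUniv_iff_of_comm {φ : d ⟶ R.obj c} {φ' : d' ⟶ R.obj c'}
    (i : d ≅ d') (j : c ≅ c') (h : φ ≫ R.map j.hom = i.hom ≫ φ') :
    IsUniv R φ ↔ IsUniv R φ' := by
  refine ⟨.of_comm (Iso.refl R) i j (by simpa using h),
    .of_comm (Iso.refl R) i.symm j.symm ?_⟩
  have : φ' = i.inv ≫ φ ≫ R.map j.hom := by rw [h, i.inv_hom_id_assoc]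
  simp [this, ← Functor.map_comp]

theorem isCouniv_iff_of_comm {φ : R.obj c ⟶ d} {φ' : R.obj c' ⟶ d'}
    (i : d ≅ d') (j : c ≅ c') (h : φ ≫ i.hom = R.map j.hom ≫ φ') :
    IsCouniv R φ ↔ IsCouniv R φ' := by
  refine ⟨.of_comm (Iso.refl R) i j (by simpa using h),
    .of_comm (Iso.refl R) i.symm j.symm ?_⟩
  have : φ = R.map j.hom ≫ φ' ≫ i.inv := by rw [← Category.assoc, ← h]; simp
  simp [this, ← Functor.map_comp_assoc]

theorem isUniv_unit {L : E ⥤ C} (adj : L ⊣ R) (d : E) :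
    IsUniv (d := d) (c := L.obj d) R (adj.unit.app d) := by
  intro Z
  have : (fun h : L.obj d ⟶ Z => (adj.unit.app d : d ⟶ R.obj (L.obj d)) ≫ R.map h) =
      adj.homEquiv d Z := by
    funext h
    exact (adj.homEquiv_unit _ _ _).symm
  rw [this]
  exact (adj.homEquiv d Z).bijective

theorem isCouniv_counit {L : E ⥤ C} (adj : R ⊣ L) (d : E) :
    IsCouniv (d := d) (c := L.obj d) R (adj.counit.app d) := by
  intro Z
  have : (fun h : Z ⟶ L.obj d => R.map h ≫ (adj.counit.app d : R.obj (L.obj d) ⟶ d)) =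
      (adj.homEquiv Z d).symm := by
    funext h
    exact (adj.homEquiv_counit _ _ _).symm
  rw [this]
  exact (adj.homEquiv Z d).symm.bijective

/-- By the triangle identity, `𝟙 (R.obj X)` is the unit followed by the image of the counit. This
expresses that `X` is a left Kan extension without choosing an adjoint. -/
theorem isUniv_id_iff_isIso_counit {L : E ⥤ C} (adj : L ⊣ R) (X : C) :
    IsUniv R (𝟙 (R.obj X)) ↔ IsIso (adj.counit.app X) := by
  refine Iff.trans ?_ (isUniv_comp_map_iff (isUniv_unit adj _) (adj.counit.app X))
  exact iff_of_eq (congrArg _ (adj.right_triangle_components X).symm)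

theorem isCouniv_id_iff_isIso_unit {L : E ⥤ C} (adj : R ⊣ L) (X : C) :
    IsCouniv R (𝟙 (R.obj X)) ↔ IsIso (adj.unit.app X) := by
  refine Iff.trans ?_ (isCouniv_map_comp_iff (isCouniv_counit adj _) (adj.unit.app X))
  exact iff_of_eq (congrArg _ (adj.left_triangle_components X).symm)

end Universal

/-! ### Componentwise 2-functoriality of restriction -/

namespace Prederivator

variable (D : Prederivator.{w, v, u}) {A B J K L P : Cat.{w, w}}

theorem resMap_id (f : A ⟶ B) : D.resMap (𝟙 f) = 𝟙 _ :=
  congrArg Cat.Hom₂.toNatTrans (D.map₂_id f.op)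

theorem resMap_comp {f g h : A ⟶ B} (α : f ⟶ g) (β : g ⟶ h) :
    D.resMap (α ≫ β) = D.resMap α ≫ D.resMap β :=
  congrArg Cat.Hom₂.toNatTrans (D.map₂_comp (op2 α) (op2 β))

/-- The isomorphism of restriction functors induced by an isomorphism of functors. -/
@[simps]
def resIso {f g : A ⟶ B} (e : f ≅ g) : D.res f ≅ D.res g where
  hom := D.resMap e.hom
  inv := D.resMap e.inv
  hom_inv_id := by rw [← resMap_comp, e.hom_inv_id, resMap_id]
  inv_hom_id := by rw [← resMap_comp, e.inv_hom_id, resMap_id]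

/-- The 1-cell dual exchanges the two whiskerings, hence the use of `map₂_whisker_right` here and of
`map₂_whisker_left` below. -/
theorem resMap_whiskerLeft (k : K ⟶ J) {f g : J ⟶ P} (α : f ⟶ g) (X : D.Diag P) :
    (D.resMap (k ◁ α)).app X ≫ (D.resComp k g).hom.app X =
      (D.resComp k f).hom.app X ≫ (D.res k).map ((D.resMap α).app X) := by
  have := congr(($(D.map₂_whisker_right (op2 α) k.op)).toNatTrans.app X)
  erw [this]
  simp

theorem resMap_whiskerRight {f g : K ⟶ J} (α : f ⟶ g) (k : J ⟶ P) (X : D.Diag P) :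
    (D.resMap (α ▷ k)).app X ≫ (D.resComp g k).hom.app X =
      (D.resComp f k).hom.app X ≫ (D.resMap α).app ((D.res k).obj X) := by
  have := congr(($(D.map₂_whisker_left k.op (op2 α))).toNatTrans.app X)
  erw [this]
  simp

theorem resMap_associator_inv (f : L ⟶ K) (g : K ⟶ J) (h : J ⟶ P) (X : D.Diag P) :
    (D.resMap (α_ f g h).inv).app X ≫ (D.resComp (f ≫ g) h).hom.app X ≫
        (D.resComp f g).hom.app ((D.res h).obj X) =
      (D.resComp f (g ≫ h)).hom.app X ≫ (D.res f).map ((D.resComp g h).hom.app X) := by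
  have := congr(($(D.mapComp_assoc_left_hom h.op g.op f.op)).toNatTrans.app X)
  refine Eq.trans ?_ this.symm
  exact congrArg (_ ≫ ·) (congrArg (_ ≫ ·) (Category.comp_id _).symm)

theorem resMap_associator_hom (f : L ⟶ K) (g : K ⟶ J) (h : J ⟶ P) (X : D.Diag P) :
    (D.resMap (α_ f g h).hom).app X ≫ (D.resComp f (g ≫ h)).hom.app X ≫
        (D.res f).map ((D.resComp g h).hom.app X) =
      (D.resComp (f ≫ g) h).hom.app X ≫ (D.resComp f g).hom.app ((D.res h).obj X) := by
  rw [← resMap_associator_inv, ← NatTrans.comp_app_assoc, ← resMap_comp, Iso.hom_inv_id, resMap_id,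
    NatTrans.id_app, Category.id_comp]

end Prederivator

/-! ### Colimiting cocones and limiting cones -/

variable (D : Prederivator.{w, v, u}) {A B J K P Q : Cat.{w, w}}

/-- The comparison arrow `g^* X ⟶ q^* v^* X` of a cocone `g ⟶ q ≫ v` with vertex `v`. -/
abbrev coconeMap {V : Cat.{w, w}} {g : J ⟶ P} {q : J ⟶ V} {v : V ⟶ P} (l : g ⟶ q ≫ v)
    (X : D.Diag P) :
    (D.res g).obj X ⟶ (D.res q).obj ((D.res v).obj X) :=
  (D.resMap l).app X ≫ (D.resComp q v).hom.app X

/-- The comparison arrow `q^* v^* X ⟶ g^* X` of a cone `q ≫ v ⟶ g` with vertex `v`. -/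
abbrev coneMap {V : Cat.{w, w}} {g : J ⟶ P} {q : J ⟶ V} {v : V ⟶ P} (l : q ≫ v ⟶ g)
    (X : D.Diag P) :
    (D.res q).obj ((D.res v).obj X) ⟶ (D.res g).obj X :=
  (D.resComp q v).inv.app X ≫ (D.resMap l).app X

/-- The cocone `l` exhibits the value of `X` at `v` as the homotopy colimit of `g^* X`. -/
def IsColim {V : Cat.{w, w}} {g : J ⟶ P} {q : J ⟶ V} {v : V ⟶ P} (l : g ⟶ q ≫ v)
    (X : D.Diag P) : Prop :=
  IsUniv (D.res q) (coconeMap D l X)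

/-- The cone `l` exhibits the value of `X` at `v` as the homotopy limit of `g^* X`. -/
def IsLim {V : Cat.{w, w}} {g : J ⟶ P} {q : J ⟶ V} {v : V ⟶ P} (l : q ≫ v ⟶ g)
    (X : D.Diag P) : Prop :=
  IsCouniv (D.res q) (coneMap D l X)

variable {D} {V : Cat.{w, w}}

theorem isColim_congr {g g' : J ⟶ P} {q : J ⟶ V} {v v' : V ⟶ P} {l : g ⟶ q ≫ v}
    {l' : g' ⟶ q ≫ v'} (e : g ≅ g') (e' : v ≅ v') (h : l ≫ q ◁ e'.hom = e.hom ≫ l')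
    (X : D.Diag P) : IsColim D l X ↔ IsColim D l' X := by
  refine isUniv_iff_of_comm ((D.resIso e).app X) ((D.resIso e').app X) ?_
  dsimp [coconeMap]
  rw [Category.assoc, Prederivator.resIso_hom, Prederivator.resIso_hom, ← D.resMap_whiskerLeft,
    ← NatTrans.comp_app_assoc, ← D.resMap_comp, h,
    D.resMap_comp, NatTrans.comp_app_assoc]

theorem isLim_congr {g g' : J ⟶ P} {q : J ⟶ V} {v v' : V ⟶ P} {l : q ≫ v ⟶ g}
    {l' : q ≫ v' ⟶ g'} (e : g ≅ g') (e' : v ≅ v') (h : l ≫ e.hom = q ◁ e'.hom ≫ l')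
    (X : D.Diag P) : IsLim D l X ↔ IsLim D l' X := by
  refine isCouniv_iff_of_comm ((D.resIso e).app X) ((D.resIso e').app X) ?_
  dsimp [coneMap]
  rw [Category.assoc, Prederivator.resIso_hom, Prederivator.resIso_hom, ← NatTrans.comp_app,
    ← D.resMap_comp, h,
    D.resMap_comp, NatTrans.comp_app, ← cancel_epi ((D.resComp q v).hom.app X),
    Iso.hom_inv_id_app_assoc,
    ← reassoc_of% D.resMap_whiskerLeft, Iso.hom_inv_id_app_assoc]

theorem isColim_res_iff {g : J ⟶ Q} {q : J ⟶ V} {v : V ⟶ Q} (l : g ⟶ q ≫ v) (h : Q ⟶ P)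
    (X : D.Diag P) :
    IsColim D l ((D.res h).obj X) ↔ IsColim D (l ▷ h ≫ (α_ q v h).hom) X := by
  symm
  refine isUniv_iff_of_comm ((D.resComp g h).app X) ((D.resComp v h).app X) ?_
  dsimp [coconeMap]
  simp only [D.resMap_comp, NatTrans.comp_app, Category.assoc]
  rw [D.resMap_associator_hom, reassoc_of% D.resMap_whiskerRight]

theorem isLim_res_iff {g : J ⟶ Q} {q : J ⟶ V} {v : V ⟶ Q} (l : q ≫ v ⟶ g) (h : Q ⟶ P)
    (X : D.Diag P) :
    IsLim D l ((D.res h).obj X) ↔ IsLim D ((α_ q v h).inv ≫ l ▷ h) X := by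
  symm
  refine isCouniv_iff_of_comm ((D.resComp g h).app X) ((D.resComp v h).app X) ?_
  dsimp [coneMap]
  rw [← cancel_epi ((D.resComp q (v ≫ h)).hom.app X), Category.assoc, Iso.hom_inv_id_app_assoc]
  simp only [D.resMap_comp, NatTrans.comp_app, Category.assoc]
  rw [D.resMap_whiskerRight, ← reassoc_of% D.resMap_associator_inv, Iso.hom_inv_id_app_assoc]

/-! ### Restriction along adjoints and finality -/

/-- An adjunction between functors of small categories, in the 1-cell dual. -/
def opAdjunction {l : J ⟶ K} {k : K ⟶ J} (adj : l.toFunctor ⊣ k.toFunctor) :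
    Bicategory.Adjunction k.op l.op where
  unit := op2 (Cat.Hom₂.ofNatTrans adj.unit)
  counit := op2 (Cat.Hom₂.ofNatTrans adj.counit)
  left_triangle := by
    apply catOp_hom₂_ext
    intro X
    simp [leftZigzag, bicategoricalComp]
  right_triangle := by
    apply catOp_hom₂_ext
    intro X
    simp [rightZigzag, bicategoricalComp]

variable (D) in
/-- Restriction along adjoint functors. -/
def resAdjunction {l : J ⟶ K} {k : K ⟶ J} (adj : l.toFunctor ⊣ k.toFunctor) :
    D.res k ⊣ D.res l :=
  Adjunction.ofCat (D.toPseudofunctor.mapAdjunction (opAdjunction adj))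

section

universe v₁ v₂ u₁ u₂

variable {C : Type u₁} [Category.{v₁} C] {E : Type u₂} [Category.{v₂} E] {L : C ⥤ E} {R : E ⥤ C}

/-- Under the hom-set bijection of the adjunction, applying `L` becomes composition with the unit at
`Y`. -/
theorem map_bijective_of_isIso_unit (adj : L ⊣ R) (W Y : C) (h : IsIso (adj.unit.app Y)) :
    Function.Bijective (L.map : (W ⟶ Y) → _) := by
  have : (adj.homEquiv W (L.obj Y)) ∘ L.map = fun f : W ⟶ Y => f ≫ adj.unit.app Y := by
    funext f
    simp [Adjunction.homEquiv_unit]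
  refine ((adj.homEquiv W (L.obj Y)).comp_bijective _).1 ?_
  rw [this]
  exact bijective_comp_right _

theorem map_bijective_of_isIso_counit (adj : L ⊣ R) (W Y : E) (h : IsIso (adj.counit.app W)) :
    Function.Bijective (R.map : (W ⟶ Y) → _) := by
  have : (adj.homEquiv (R.obj W) Y).symm ∘ R.map = fun f : W ⟶ Y => adj.counit.app W ≫ f := by
    funext f
    simp [Adjunction.homEquiv_counit]
  refine ((adj.homEquiv (R.obj W) Y).symm.comp_bijective _).1 ?_
  rw [this]
  exact bijective_comp_left _

end

theorem isIso_cat {f g : A ⟶ B} (α : f ⟶ g) (h : ∀ a : A, IsIso (α.toNatTrans.app a)) :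
    IsIso α := by
  have := NatIso.isIso_of_isIso_app α.toNatTrans
  exact (Cat.Hom.isoMk (asIso α.toNatTrans)).isIso_hom

theorem isIso_to_pt {f g : A ⟶ pt.{w}} (α : f ⟶ g) : IsIso α :=
  isIso_cat α fun _ =>
    ⟨⟨⟨⟨Subsingleton.elim _ _⟩⟩, rfl, rfl⟩⟩

/-- A 2-cell between functors to the terminal category is invertible, so the unit of `l ⊣ k` becomes
invertible after whiskering with `q`; the unit at a constant diagram is its image up to coherence.
-/
theorem isIso_resAdjunction_unit {l : J ⟶ K} {k : K ⟶ J} (adj : l.toFunctor ⊣ k.toFunctor)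
    (q : J ⟶ pt.{w}) (Z : D.Diag pt.{w}) :
    IsIso ((resAdjunction D adj).unit.app ((D.res q).obj Z)) := by
  let η : 𝟙 J ⟶ l ≫ k := Cat.Hom₂.ofNatTrans adj.unit
  have : IsIso (D.resMap (η ▷ q)) := by
    have := isIso_to_pt (η ▷ q)
    exact (D.resIso (asIso (η ▷ q))).isIso_hom
  have : IsIso ((D.resMap η).app ((D.res q).obj Z)) := by
    have h := D.resMap_whiskerRight η q Z
    rw [← IsIso.inv_comp_eq] at h
    rw [← h]
    infer_instance
  change IsIso (((D.mapId (op J)).inv.toNatTrans.app _) ≫ (D.resMap η).app ((D.res q).obj Z) ≫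
    (D.resComp l k).hom.app _)
  infer_instance

theorem isIso_resAdjunction_counit {l : J ⟶ K} {k : K ⟶ J} (adj : l.toFunctor ⊣ k.toFunctor)
    (q : K ⟶ pt.{w}) (Z : D.Diag pt.{w}) :
    IsIso ((resAdjunction D adj).counit.app ((D.res q).obj Z)) := by
  let e : k ≫ l ⟶ 𝟙 K := Cat.Hom₂.ofNatTrans adj.counit
  have : IsIso (D.resMap (e ▷ q)) := by
    have := isIso_to_pt (e ▷ q)
    exact (D.resIso (asIso (e ▷ q))).isIso_hom
  have : IsIso ((D.resMap e).app ((D.res q).obj Z)) := by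
    have h := D.resMap_whiskerRight e q Z
    rw [← IsIso.inv_comp_eq] at h
    rw [← h]
    infer_instance
  change IsIso (((D.resComp k l).inv.app _) ≫ (D.resMap e).app ((D.res q).obj Z) ≫
    (D.mapId (op K)).hom.toNatTrans.app _)
  infer_instance

/-- Finality of right adjoints: `k^*` is left adjoint to `l^*` with invertible unit at constant
diagrams, so it is bijective on arrows into constant diagrams, which is all that universality tests.
-/
theorem isColim_comp_iff {l : J ⟶ K} {k : K ⟶ J} (adj : l.toFunctor ⊣ k.toFunctor)
    {g : J ⟶ P} {q : J ⟶ pt.{w}} {v : pt.{w} ⟶ P} (c : g ⟶ q ≫ v) (X : D.Diag P) :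
    IsColim D (k ◁ c ≫ (α_ k q v).inv) X ↔ IsColim D c X := by
  have h1 : IsUniv (D.res q ⋙ D.res k) (c := (D.res v).obj X) ((D.res k).map (coconeMap D c X)) ↔
      IsColim D c X := by
    refine forall_congr' fun Z => ?_
    have : (fun h : (D.res v).obj X ⟶ Z =>
        (D.res k).map (coconeMap D c X) ≫ (D.res q ⋙ D.res k).map h) =
      (D.res k).map ∘ fun h : (D.res v).obj X ⟶ Z => coconeMap D c X ≫ (D.res q).map h := by
      funext h
      exact ((D.res k).map_comp _ _).symm
    rw [this]
    exact (map_bijective_of_isIso_unit (resAdjunction D adj) _ _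
      (isIso_resAdjunction_unit adj q Z)).of_comp_iff' _
  have h2 : coconeMap D (k ◁ c ≫ (α_ k q v).inv) X ≫ (D.resComp k q).hom.app ((D.res v).obj X) =
      (D.resComp k g).hom.app X ≫ (D.res k).map (coconeMap D c X) := by
    dsimp [coconeMap]
    rw [Functor.map_comp, D.resMap_comp, NatTrans.comp_app, Category.assoc, Category.assoc,
      D.resMap_associator_inv, reassoc_of% D.resMap_whiskerLeft]
  rw [← h1]
  constructor
  · refine IsUniv.of_comm (D.resComp k q) ((D.resComp k g).app X) (Iso.refl _) ?_
    simpa using h2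
  · refine IsUniv.of_comm (D.resComp k q).symm ((D.resComp k g).app X).symm (Iso.refl _) ?_
    have h3 := (Iso.eq_comp_inv ((D.resComp k q).app ((D.res v).obj X))).2 h2
    simp [h3]

/-- Dually, left adjoints are initial: `l^*` is bijective on arrows out of constant diagrams. -/
theorem isLim_comp_iff {l : J ⟶ K} {k : K ⟶ J} (adj : l.toFunctor ⊣ k.toFunctor)
    {g : K ⟶ P} {q : K ⟶ pt.{w}} {v : pt.{w} ⟶ P} (c : q ≫ v ⟶ g) (X : D.Diag P) :
    IsLim D ((α_ l q v).hom ≫ l ◁ c) X ↔ IsLim D c X := by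
  have h1 : IsCouniv (D.res q ⋙ D.res l) (c := (D.res v).obj X) ((D.res l).map (coneMap D c X)) ↔
      IsLim D c X := by
    refine forall_congr' fun Z => ?_
    have : (fun h : Z ⟶ (D.res v).obj X =>
        (D.res q ⋙ D.res l).map h ≫ (D.res l).map (coneMap D c X)) =
      (D.res l).map ∘ fun h : Z ⟶ (D.res v).obj X => (D.res q).map h ≫ coneMap D c X := by
      funext h
      exact ((D.res l).map_comp _ _).symm
    rw [this]
    exact (map_bijective_of_isIso_counit (resAdjunction D adj) _ _
      (isIso_resAdjunction_counit adj q Z)).of_comp_iff' _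
  have h2 : coneMap D ((α_ l q v).hom ≫ l ◁ c) X ≫ (D.resComp l g).hom.app X =
      (D.resComp l q).hom.app ((D.res v).obj X) ≫ (D.res l).map (coneMap D c X) := by
    dsimp [coneMap]
    rw [← cancel_epi ((D.resComp (l ≫ q) v).hom.app X)]
    simp only [Functor.map_comp, D.resMap_comp, NatTrans.comp_app, Category.assoc,
      D.resMap_whiskerLeft, Iso.hom_inv_id_app_assoc]
    rw [← reassoc_of% D.resMap_associator_hom, ← Functor.map_comp_assoc (D.res l),
      Iso.hom_inv_id_app]
    simp
  rw [← h1]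
  constructor
  · refine IsCouniv.of_comm (D.resComp l q) ((D.resComp l g).app X) (Iso.refl _) ?_
    simpa using h2
  · refine IsCouniv.of_comm (D.resComp l q).symm ((D.resComp l g).app X).symm (Iso.refl _) ?_
    have h3 := (Iso.inv_comp_eq ((D.resComp l q).app ((D.res v).obj X))).2 h2
    rw [← cancel_mono ((D.resComp l g).app X).hom, Iso.symm_hom, Category.assoc, Iso.inv_hom_id,
      Category.comp_id, ← h3]
    simp

/-! ### Universal arrows for the identity and thin adjunctions -/

section

universe v₁ v₂ u₁ u₂

variable {C : Type u₁} [Category.{v₁} C] {E : Type u₂} [Category.{v₂} E]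

theorem isUniv_iff_isIso {R : C ⥤ C} (r : R ≅ 𝟭 C) {d c : C} (φ : d ⟶ R.obj c) :
    IsUniv R φ ↔ IsIso φ := by
  have h1 : IsUniv R φ ↔ IsUniv (𝟭 C) (c := c) (φ ≫ r.hom.app c) := by
    constructor
    · exact IsUniv.of_comm r (Iso.refl _) (Iso.refl _) (by simp)
    · exact IsUniv.of_comm r.symm (Iso.refl _) (Iso.refl _) (by simp)
  have h2 : IsUniv (𝟭 C) (c := c) (φ ≫ r.hom.app c) ↔ IsIso (φ ≫ r.hom.app c) :=
    ⟨fun h => isIso_of_bijective_comp_left _ h, fun _ Z => bijective_comp_left _⟩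
  rw [h1, h2]
  exact ⟨fun _ => IsIso.of_isIso_comp_right φ (r.hom.app c), fun _ => inferInstance⟩

theorem isCouniv_iff_isIso {R : C ⥤ C} (r : R ≅ 𝟭 C) {d c : C} (φ : R.obj c ⟶ d) :
    IsCouniv R φ ↔ IsIso φ := by
  have h1 : IsCouniv R φ ↔ IsCouniv (𝟭 C) (c := c) (r.inv.app c ≫ φ) := by
    constructor
    · exact IsCouniv.of_comm r (Iso.refl _) (Iso.refl _) (by simp)
    · exact IsCouniv.of_comm r.symm (Iso.refl _) (Iso.refl _) (by simp)
  have h2 : IsCouniv (𝟭 C) (c := c) (r.inv.app c ≫ φ) ↔ IsIso (r.inv.app c ≫ φ) :=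
    ⟨fun h => isIso_of_bijective_comp_right _ h, fun _ Z => bijective_comp_right _⟩
  rw [h1, h2]
  exact ⟨fun _ => IsIso.of_isIso_comp_left (r.inv.app c) φ, fun _ => inferInstance⟩

/-- Functors between which all relevant hom-sets are subsingletons are adjoint as soon as these
hom-sets are inhabited simultaneously. -/
def adjunctionOfSubsingleton (F : C ⥤ E) (G : E ⥤ C)
    (h₁ : ∀ X Y, Subsingleton (F.obj X ⟶ Y)) (h₂ : ∀ X Y, Subsingleton (X ⟶ G.obj Y))
    (a : ∀ X Y, (F.obj X ⟶ Y) → (X ⟶ G.obj Y)) (b : ∀ X Y, (X ⟶ G.obj Y) → (F.obj X ⟶ Y)) :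
    F ⊣ G :=
  Adjunction.mkOfHomEquiv
    { homEquiv := fun X Y => ⟨a X Y, b X Y, fun _ => Subsingleton.elim _ _,
        fun _ => Subsingleton.elim _ _⟩
      homEquiv_naturality_left_symm := fun _ _ => Subsingleton.elim _ _
      homEquiv_naturality_right := fun _ _ => Subsingleton.elim _ _ }

end

variable {D : Prederivator.{w, v, u}} {A B J K P : Cat.{w, w}}

/-- The restriction along a functor isomorphic to the identity is isomorphic to the identity. -/
def resIsoId (D : Prederivator.{w, v, u}) {f : A ⟶ A} (e : f ≅ 𝟙 A) : D.res f ≅ 𝟭 _ :=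
  D.resIso e ≪≫ Cat.Hom.toNatIso (D.mapId (op A))

/-- The finality argument for arrows that need not come from a cocone, as required for the units of
Kan extensions. -/
theorem isUniv_res_map_iff {l : J ⟶ K} {k : K ⟶ J} (adj : l.toFunctor ⊣ k.toFunctor)
    {q : J ⟶ pt.{w}} {W : D.Diag J} {Z : D.Diag pt.{w}} (φ : W ⟶ (D.res q).obj Z) :
    IsUniv (D.res q ⋙ D.res k) (c := Z) ((D.res k).map φ) ↔ IsUniv (D.res q) φ := by
  refine forall_congr' fun Z' => ?_
  have : (fun h : Z ⟶ Z' => (D.res k).map φ ≫ (D.res q ⋙ D.res k).map h) =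
      (D.res k).map ∘ fun h : Z ⟶ Z' => φ ≫ (D.res q).map h := by
    funext h
    exact ((D.res k).map_comp _ _).symm
  rw [this]
  exact (map_bijective_of_isIso_unit (resAdjunction D adj) _ _
    (isIso_resAdjunction_unit adj q Z')).of_comp_iff' _

theorem isCouniv_res_map_iff {l : J ⟶ K} {k : K ⟶ J} (adj : l.toFunctor ⊣ k.toFunctor)
    {q : K ⟶ pt.{w}} {W : D.Diag K} {Z : D.Diag pt.{w}} (φ : (D.res q).obj Z ⟶ W) :
    IsCouniv (D.res q ⋙ D.res l) (c := Z) ((D.res l).map φ) ↔ IsCouniv (D.res q) φ := by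
  refine forall_congr' fun Z' => ?_
  have : (fun h : Z' ⟶ Z => (D.res q ⋙ D.res l).map h ≫ (D.res l).map φ) =
      (D.res l).map ∘ fun h : Z' ⟶ Z => (D.res q).map h ≫ φ := by
    funext h
    exact ((D.res l).map_comp _ _).symm
  rw [this]
  exact (map_bijective_of_isIso_counit (resAdjunction D adj) _ _
    (isIso_resAdjunction_counit adj q Z')).of_comp_iff' _

/-! ### Slices of fully faithful functors -/

section Slices

variable (f : A ⟶ B)

theorem isUniv_square_iff (b : B) (X : D.Diag B) :
    IsUniv (D.res (overPi f b)) ((D.square (overTrans f b)).app X) ↔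
      IsColim D (overTrans f b) X := by
  refine isUniv_iff_of_comm ((D.resComp _ _).symm.app X) (Iso.refl _) ?_
  simp [Prederivator.square, coconeMap]

theorem isCouniv_square_iff (b : B) (X : D.Diag B) :
    IsCouniv (D.res (underPi f b)) ((D.square (underTrans f b)).app X) ↔
      IsLim D (underTrans f b) X := by
  refine isCouniv_iff_of_comm ((D.resComp _ _).symm.app X) (Iso.refl _) ?_
  simp only [Prederivator.square, coneMap, NatTrans.comp_app, Category.assoc, Iso.refl_hom,
    Iso.app_hom, Iso.symm_hom, Iso.hom_inv_id_app]
  rw [CategoryTheory.Functor.map_id, Category.id_comp]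
  exact congrArg (_ ≫ ·) (Category.comp_id _)

/-- The object of `f / f a` given by the identity. -/
abbrev overTerminal (a : A) : overSlice f (f.toFunctor.obj a) :=
  Comma.mk (L := f.toFunctor) (R := Functor.fromPUnit.{w} (f.toFunctor.obj a))
    a ⟨⟨⟩⟩ (𝟙 (f.toFunctor.obj a))

/-- The object of `f a / f` given by the identity. -/
abbrev underInitial (a : A) : underSlice f (f.toFunctor.obj a) :=
  Comma.mk (R := f.toFunctor) (L := Functor.fromPUnit.{w} (f.toFunctor.obj a))
    ⟨⟨⟩⟩ a (𝟙 (f.toFunctor.obj a))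

/-- For a fully faithful functor `f`, the slice `f / f a` has a terminal object. -/
noncomputable def overTerminalAdjunction [f.toFunctor.Full] [f.toFunctor.Faithful] (a : A) :
    (overPi f (f.toFunctor.obj a)).toFunctor ⊣ (pick (overTerminal f a)).toFunctor :=
  adjunctionOfSubsingleton _ _
    (fun X Y => ⟨fun g h => Subsingleton.elim (α := ULift (PLift _)) g h⟩)
    (fun X Y => ⟨fun g h => by
      refine CommaMorphism.ext (f.toFunctor.map_injective ?_)
        (Subsingleton.elim (α := ULift (PLift _)) _ _)
      exact (Category.comp_id _).symm.trans ((g.w.trans h.w.symm).trans (Category.comp_id _))⟩)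
    (fun X Y _ => ⟨f.toFunctor.preimage X.hom, ⟨⟨Subsingleton.elim _ _⟩⟩,
      (Category.comp_id _).trans
        ((f.toFunctor.map_preimage X.hom).trans (Category.comp_id _).symm)⟩)
    (fun X Y _ => ⟨⟨Subsingleton.elim _ _⟩⟩)

/-- For a fully faithful functor `f`, the slice `f a / f` has an initial object. -/
noncomputable def underInitialAdjunction [f.toFunctor.Full] [f.toFunctor.Faithful] (a : A) :
    (pick (underInitial f a)).toFunctor ⊣ (underPi f (f.toFunctor.obj a)).toFunctor :=
  adjunctionOfSubsingleton _ _
    (fun X Y => ⟨fun g h => by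
      refine CommaMorphism.ext (Subsingleton.elim (α := ULift (PLift _)) _ _)
        (f.toFunctor.map_injective ?_)
      exact (Category.id_comp _).symm.trans ((g.w.symm.trans h.w).trans (Category.id_comp _))⟩)
    (fun X Y => ⟨fun g h => Subsingleton.elim (α := ULift (PLift _)) g h⟩)
    (fun X Y _ => ⟨⟨Subsingleton.elim _ _⟩⟩)
    (fun X Y _ => ⟨⟨⟨Subsingleton.elim _ _⟩⟩, f.toFunctor.preimage Y.hom,
      (Category.id_comp _).trans
        ((f.toFunctor.map_preimage Y.hom).symm.trans (Category.id_comp _).symm)⟩)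

theorem isIso_coconeMap {V : Cat.{w, w}} {g : J ⟶ P} {q : J ⟶ V} {v : V ⟶ P} (c : g ⟶ q ≫ v)
    [IsIso c] (X : D.Diag P) : IsIso (coconeMap D c X) := by
  have : IsIso (D.resMap c) := (D.resIso (asIso c)).isIso_hom
  unfold coconeMap
  infer_instance

theorem isIso_coneMap {V : Cat.{w, w}} {g : J ⟶ P} {q : J ⟶ V} {v : V ⟶ P} (c : q ≫ v ⟶ g)
    [IsIso c] (X : D.Diag P) : IsIso (coneMap D c X) := by
  have : IsIso (D.resMap c) := (D.resIso (asIso c)).isIso_hom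
  unfold coneMap
  infer_instance

instance isIso_overTrans_terminal (a : A) :
    IsIso (pick (overTerminal f a) ◁ overTrans f (f.toFunctor.obj a)) :=
  isIso_cat _ fun _ => inferInstanceAs (IsIso (𝟙 (f.toFunctor.obj a)))

instance isIso_underTrans_initial (a : A) :
    IsIso (pick (underInitial f a) ◁ underTrans f (f.toFunctor.obj a)) :=
  isIso_cat _ fun _ => inferInstanceAs (IsIso (𝟙 (f.toFunctor.obj a)))

/-- The terminal object of the slice is picked by a right adjoint, hence is final, and the cocone
restricts to an invertible 2-cell there. -/
theorem isColim_overTrans_obj [f.toFunctor.Full] [f.toFunctor.Faithful] (a : A) (X : D.Diag B) :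
    IsColim D (overTrans f (f.toFunctor.obj a)) X := by
  rw [← isColim_comp_iff (overTerminalAdjunction f a)]
  refine (isUniv_iff_isIso (resIsoId D (Iso.refl _)) _).2 ?_
  exact isIso_coconeMap _ _

theorem isLim_underTrans_obj [f.toFunctor.Full] [f.toFunctor.Faithful] (a : A) (X : D.Diag B) :
    IsLim D (underTrans f (f.toFunctor.obj a)) X := by
  rw [← isLim_comp_iff (underInitialAdjunction f a)]
  refine (isCouniv_iff_isIso (resIsoId D (Iso.refl _)) _).2 ?_
  exact isIso_coneMap _ _

end Slices

/-! ### Pointwise criteria from (Der4) -/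

section Kan

variable (f : A ⟶ B)

/-- The arrow is the unit of `π_! ⊣ π^*` followed by the image of the mate, which (Der4) makes
invertible. -/
theorem isUniv_unit_square (hD : IsDerivator D) {lan : D.Diag A ⥤ D.Diag B}
    (adj : lan ⊣ D.res f) (b : B)
    (Y : D.Diag A) :
    IsUniv (d := (D.res (overProj f b)).obj Y) (c := (D.res (pick b)).obj (lan.obj Y))
      (D.res (overPi f b))
      ((D.res (overProj f b)).map (adj.unit.app Y) ≫
        (D.square (overTrans f b)).app (lan.obj Y)) := by
  obtain ⟨_, ⟨adj'⟩⟩ := hD.der3_left (overPi f b)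
  have h := unit_mateEquiv_symm adj adj' (TwoSquare.mk _ _ _ _ (D.square (overTrans f b))) Y
  have := hD.der4_left f b adj adj'
  have h' := (isUniv_comp_map_iff (isUniv_unit adj' ((D.res (overProj f b)).obj Y))
    (((mateEquiv adj adj').symm
      (TwoSquare.mk _ _ _ _ (D.square (overTrans f b)))).natTrans.app Y)).2
    inferInstance
  exact h.symm ▸ h'

theorem isCouniv_counit_square (hD : IsDerivator D) {ran : D.Diag A ⥤ D.Diag B}
    (adj : D.res f ⊣ ran) (b : B)
    (Y : D.Diag A) :
    IsCouniv (d := (D.res (underProj f b)).obj Y) (c := (D.res (pick b)).obj (ran.obj Y))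
      (D.res (underPi f b))
      ((D.square (underTrans f b)).app (ran.obj Y) ≫
        (D.res (underProj f b)).map (adj.counit.app Y)) := by
  obtain ⟨_, ⟨adj'⟩⟩ := hD.der3_right (underPi f b)
  have h := mateEquiv_counit adj adj' (TwoSquare.mk _ _ _ _ (D.square (underTrans f b))) Y
  have := hD.der4_right f b adj adj'
  have h' := (isCouniv_map_comp_iff (isCouniv_counit adj' ((D.res (underProj f b)).obj Y))
    ((mateEquiv adj adj' (TwoSquare.mk _ _ _ _ (D.square (underTrans f b)))).natTrans.app Y)).2
    inferInstance
  exact h ▸ h'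

/-- By (Der2) the counit is tested at each `b`. Composing the universal arrow of
`isUniv_unit_square` with the counit at `b` gives the canonical cocone, by naturality and a triangle
identity. -/
theorem isUniv_id_iff (hD : IsDerivator D) (X : D.Diag B) :
    IsUniv (D.res f) (𝟙 ((D.res f).obj X)) ↔ ∀ b, IsColim D (overTrans f b) X := by
  obtain ⟨lan, ⟨adj⟩⟩ := hD.der3_left f
  rw [isUniv_id_iff_isIso_counit adj, hD.der2]
  refine forall_congr' fun b => ?_
  rw [← isUniv_square_iff]
  have h := isUniv_unit_square f hD adj b ((D.res f).obj X)
  refine (isUniv_comp_map_iff h ((D.res (pick b)).map (adj.counit.app X))).symm.trans ?_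
  have h2 := (D.square (overTrans f b)).naturality (adj.counit.app X)
  have h3 := adj.right_triangle_components X
  apply iff_of_eq
  congr 1
  rw [Category.assoc]
  refine (congrArg (_ ≫ ·) h2.symm).trans ?_
  refine (Category.assoc _ _ _).symm.trans ?_
  refine (congrArg (· ≫ _) (((D.res (overProj f b)).map_comp _ _).symm.trans
    (congrArg (D.res (overProj f b)).map h3))).trans ?_
  simp

theorem isCouniv_id_iff (hD : IsDerivator D) (X : D.Diag B) :
    IsCouniv (D.res f) (𝟙 ((D.res f).obj X)) ↔ ∀ b, IsLim D (underTrans f b) X := by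
  obtain ⟨ran, ⟨adj⟩⟩ := hD.der3_right f
  rw [isCouniv_id_iff_isIso_unit adj, hD.der2]
  refine forall_congr' fun b => ?_
  rw [← isCouniv_square_iff]
  have h := isCouniv_counit_square f hD adj b ((D.res f).obj X)
  refine (isCouniv_map_comp_iff h ((D.res (pick b)).map (adj.unit.app X))).symm.trans ?_
  have h2 := (D.square (underTrans f b)).naturality (adj.unit.app X)
  have h3 := adj.left_triangle_components X
  apply iff_of_eq
  congr 1
  refine (Category.assoc _ _ _).symm.trans ?_
  refine (congrArg (· ≫ _) h2).trans ?_
  refine (Category.assoc _ _ _).trans ?_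
  refine (congrArg (_ ≫ ·) (((D.res (underProj f b)).map_comp _ _).symm.trans
    (congrArg (D.res (underProj f b)).map h3))).trans ?_
  simp

end Kan

variable {D : Prederivator.{w, v, u}}

/-! ### Kan extensions along fully faithful functors -/

section Kan

variable {A B : Cat.{w, w}} (f : A ⟶ B) [f.toFunctor.Full] [f.toFunctor.Faithful]

/-- Evaluate the pointwise formula at the terminal object of `f / f a`: both the universal arrow and
its factor coming from the canonical cocone become invertible there, hence so does the remaining
factor, the unit at `a`. -/
theorem isIso_unit (hD : IsDerivator D) {lan : D.Diag A ⥤ D.Diag B} (adj : lan ⊣ D.res f)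
    (Y : D.Diag A) : IsIso (adj.unit.app Y) := by
  rw [hD.der2]
  intro a
  let t := pick (overTerminal f a)
  let r : D.res (overPi f (f.toFunctor.obj a)) ⋙ D.res t ≅ 𝟭 _ :=
    (D.resComp t (overPi f (f.toFunctor.obj a))).symm ≪≫ resIsoId D (Iso.refl _)
  have h1 := (isUniv_iff_isIso r _).1 ((isUniv_res_map_iff (overTerminalAdjunction f a) _).2
    (isUniv_unit_square f hD adj (f.toFunctor.obj a) Y))
  have h2 := (isUniv_iff_isIso r _).1 ((isUniv_res_map_iff (overTerminalAdjunction f a) _).2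
    ((isUniv_square_iff f _ _).2 (isColim_overTrans_obj f a (lan.obj Y))))
  rw [Functor.map_comp] at h1
  have h3 : IsIso ((D.res (overProj f (f.toFunctor.obj a)) ⋙ D.res t).map (adj.unit.app Y)) :=
    @IsIso.of_isIso_comp_right _ _ _ _ _ _ _ h2 h1
  exact (NatIso.isIso_map_iff (D.resComp t (overProj f (f.toFunctor.obj a))) _).2 h3

theorem isIso_counit (hD : IsDerivator D) {ran : D.Diag A ⥤ D.Diag B} (adj : D.res f ⊣ ran)
    (Y : D.Diag A) : IsIso (adj.counit.app Y) := by
  rw [hD.der2]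
  intro a
  let t := pick (underInitial f a)
  let r : D.res (underPi f (f.toFunctor.obj a)) ⋙ D.res t ≅ 𝟭 _ :=
    (D.resComp t (underPi f (f.toFunctor.obj a))).symm ≪≫ resIsoId D (Iso.refl _)
  have h1 := (isCouniv_iff_isIso r _).1 ((isCouniv_res_map_iff (underInitialAdjunction f a) _).2
    (isCouniv_counit_square f hD adj (f.toFunctor.obj a) Y))
  have h2 := (isCouniv_iff_isIso r _).1 ((isCouniv_res_map_iff (underInitialAdjunction f a) _).2
    ((isCouniv_square_iff f _ _).2 (isLim_underTrans_obj f a (ran.obj Y))))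
  rw [Functor.map_comp] at h1
  have h3 : IsIso ((D.res (underProj f (f.toFunctor.obj a)) ⋙ D.res t).map (adj.counit.app Y)) :=
    @IsIso.of_isIso_comp_left _ _ _ _ _ _ _ h2 h1
  exact (NatIso.isIso_map_iff (D.resComp t (underProj f (f.toFunctor.obj a))) _).2 h3

/-- Take the left Kan extension of `Y`: as the unit is invertible, a triangle identity exhibits the
counit there as the inverse of an isomorphism. -/
theorem exists_lan (hD : IsDerivator D) (Y : D.Diag A) :
    ∃ X : D.Diag B, IsUniv (D.res f) (𝟙 ((D.res f).obj X)) ∧ Nonempty ((D.res f).obj X ≅ Y) := by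
  obtain ⟨lan, ⟨adj⟩⟩ := hD.der3_left f
  have := isIso_unit f hD adj Y
  refine ⟨lan.obj Y, (isUniv_id_iff_isIso_counit adj _).2 ?_, ⟨(asIso (adj.unit.app Y)).symm⟩⟩
  have h := adj.left_triangle_components Y
  have h' : adj.counit.app (lan.obj Y) = inv (lan.map (adj.unit.app Y)) :=
    (IsIso.inv_eq_of_hom_inv_id h).symm
  rw [h']; infer_instance

theorem exists_ran (hD : IsDerivator D) (Y : D.Diag A) :
    ∃ X : D.Diag B, IsCouniv (D.res f) (𝟙 ((D.res f).obj X)) ∧ Nonempty ((D.res f).obj X ≅ Y) := by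
  obtain ⟨ran, ⟨adj⟩⟩ := hD.der3_right f
  have := isIso_counit f hD adj Y
  refine ⟨ran.obj Y, (isCouniv_id_iff_isIso_unit adj _).2 ?_, ⟨asIso (adj.counit.app Y)⟩⟩
  have h := adj.right_triangle_components Y
  have h' : adj.unit.app (ran.obj Y) = inv (ran.map (adj.counit.app Y)) :=
    (IsIso.inv_eq_of_inv_hom_id h).symm
  rw [h']; infer_instance

/-- On the image of `f` the colimit condition is automatic, so only the new objects matter. -/
theorem isUniv_id_iff_of_cover (hD : IsDerivator D) (p : B → Prop)
    (hp : ∀ b, ¬ p b → ∃ a, f.toFunctor.obj a = b) (X : D.Diag B) :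
    IsUniv (D.res f) (𝟙 ((D.res f).obj X)) ↔ ∀ b, p b → IsColim D (overTrans f b) X := by
  rw [isUniv_id_iff f hD]
  refine ⟨fun h b _ => h b, fun h b => ?_⟩
  by_cases hb : p b
  · exact h b hb
  · obtain ⟨a, rfl⟩ := hp b hb
    exact isColim_overTrans_obj f a X

theorem isCouniv_id_iff_of_cover (hD : IsDerivator D) (p : B → Prop)
    (hp : ∀ b, ¬ p b → ∃ a, f.toFunctor.obj a = b) (X : D.Diag B) :
    IsCouniv (D.res f) (𝟙 ((D.res f).obj X)) ↔ ∀ b, p b → IsLim D (underTrans f b) X := by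
  rw [isCouniv_id_iff f hD]
  refine ⟨fun h b _ => h b, fun h b => ?_⟩
  by_cases hb : p b
  · exact h b hb
  · obtain ⟨a, rfl⟩ := hp b hb
    exact isLim_underTrans_obj f a X

/-- The unit being invertible, the essential image consists of the objects with invertible counit,
whichever adjoint is used. -/
theorem exists_lan_essImage_iff (hD : IsDerivator D) (X : D.Diag B) :
    (∃ (lan : D.Diag A ⥤ D.Diag B) (_ : lan ⊣ D.res f), lan.essImage X) ↔
      IsUniv (D.res f) (𝟙 ((D.res f).obj X)) := by
  constructor
  · rintro ⟨lan, adj, Y, ⟨e⟩⟩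
    rw [isUniv_id_iff_isIso_counit adj]
    have := isIso_unit f hD adj Y
    have h := adj.left_triangle_components Y
    have h' : adj.counit.app (lan.obj Y) = inv (lan.map (adj.unit.app Y)) :=
      (IsIso.inv_eq_of_hom_inv_id h).symm
    refine (NatTrans.isIso_app_iff_of_iso adj.counit e).1 ?_
    rw [h']; infer_instance
  · intro h
    obtain ⟨lan, ⟨adj⟩⟩ := hD.der3_left f
    have := (isUniv_id_iff_isIso_counit adj _).1 h
    exact ⟨lan, adj, _, ⟨asIso (adj.counit.app X)⟩⟩

theorem exists_ran_essImage_iff (hD : IsDerivator D) (X : D.Diag B) :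
    (∃ (ran : D.Diag A ⥤ D.Diag B) (_ : D.res f ⊣ ran), ran.essImage X) ↔
      IsCouniv (D.res f) (𝟙 ((D.res f).obj X)) := by
  constructor
  · rintro ⟨ran, adj, Y, ⟨e⟩⟩
    rw [isCouniv_id_iff_isIso_unit adj]
    have := isIso_counit f hD adj Y
    have h := adj.right_triangle_components Y
    have h' : adj.unit.app (ran.obj Y) = inv (ran.map (adj.counit.app Y)) :=
      (IsIso.inv_eq_of_inv_hom_id h).symm
    refine (NatTrans.isIso_app_iff_of_iso adj.unit e).1 ?_
    rw [h']; infer_instance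
  · intro h
    obtain ⟨ran, ⟨adj⟩⟩ := hD.der3_right f
    have := (isCouniv_id_iff_isIso_unit adj _).1 h
    exact ⟨ran, adj, _, ⟨(asIso (adj.unit.app X)).symm⟩⟩

end Kan

/-! ### Preorders as categories, and inclusions with parameters -/

instance subsingleton_hom_of_preorder {P : Type w} [Preorder P] (x y : Cat.of P) :
    Subsingleton (x ⟶ y) :=
  ⟨fun g h => Subsingleton.elim (α := ULift (PLift (@LE.le P _ x y))) g h⟩

/-- The arrow given by an inequality. -/
abbrev leHom (P : Type w) [Preorder P] {x y : P} (h : x ≤ y) : Quiver.Hom (V := Cat.of P) x y :=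
  (⟨⟨h⟩⟩ : ULift (PLift (x ≤ y)))

theorem le_of_hom (P : Type w) [Preorder P] {x y : P} (g : Quiver.Hom (V := Cat.of P) x y) :
    x ≤ y :=
  PLift.down (ULift.down (α := PLift (x ≤ y)) g)

/-- The vertex `(1, 1)` of the square. -/
abbrev lowerRight : commSquare.{w} := (⟨(1, 1)⟩ : ULift.{w} (Fin 2 × Fin 2))

/-- The vertex `(0, 0)` of the square. -/
abbrev upperLeft : commSquare.{w} := (⟨(0, 0)⟩ : ULift.{w} (Fin 2 × Fin 2))

/-- The functor given by a monotone map. -/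
abbrev ordFun {P Q : Type w} [Preorder P] [Preorder Q] (f : P →o Q) : Cat.of P ⟶ Cat.of Q :=
  Functor.toCatHom f.monotone.functor

/-- The functor `A × B ⥤ E × B` induced by a functor `A ⥤ E`. -/
abbrev prodRes {A E : Cat.{w, w}} (r : A ⟶ E) (B : Cat.{w, w}) :
    Cat.of (A × B) ⟶ Cat.of (E × B) :=
  (r.toFunctor.prod (𝟭 B)).toCatHom

/-- The diagram of shape `S` in `E × B` given by a diagram in `E` and an object of `B`. -/
abbrev atPoint {S E B : Cat.{w, w}} (s : S ⟶ E) (b : B) : S ⟶ Cat.of (E × B) :=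
  (Functor.prod' s.toFunctor ((Functor.const S).obj b)).toCatHom

/-- The functor to the terminal category. -/
abbrev toPt (A : Cat.{w, w}) : A ⟶ pt.{w} :=
  Functor.toCatHom ((Functor.const A).obj ⟨⟨⟩⟩)

/-- The cocone on the upper left corner of the square whose vertex is `(1, 1)`. -/
def ulCocone : ulIncl.{w} ⟶ toPt ulCorner ≫ pick lowerRight :=
  Cat.Hom₂.ofNatTrans
    { app := fun x => leHom (ULift.{w} (Fin 2 × Fin 2))
        (show x.1 ≤ ⟨(1, 1)⟩ from ⟨Fin.le_last _, Fin.le_last _⟩)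
      naturality := fun _ _ _ => Subsingleton.elim _ _ }

/-- The cone on the lower right corner of the square whose vertex is `(0, 0)`. -/
def lrCone : toPt lrCorner ≫ pick upperLeft ⟶ lrIncl.{w} :=
  Cat.Hom₂.ofNatTrans
    { app := fun x => leHom (ULift.{w} (Fin 2 × Fin 2))
        (show (⟨(0, 0)⟩ : ULift (Fin 2 × Fin 2)) ≤ x.1 from ⟨Fin.zero_le _, Fin.zero_le _⟩)
      naturality := fun _ _ _ => Subsingleton.elim _ _ }

instance ordFun_full {P Q : Type w} [Preorder P] [Preorder Q] (f : P ↪o Q) :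
    (ordFun f.toOrderHom).toFunctor.Full :=
  ⟨fun g => ⟨leHom P (f.le_iff_le.1 (le_of_hom Q g)), rfl⟩⟩

instance ordFun_faithful {P Q : Type w} [Preorder P] [Preorder Q] (f : P →o Q) :
    (ordFun f).toFunctor.Faithful :=
  ⟨fun _ => Subsingleton.elim _ _⟩

instance ulIncl_full : ulIncl.{w}.toFunctor.Full :=
  ⟨fun g => ⟨leHom {x : ULift.{w} (Fin 2 × Fin 2) // x.down ≠ (1, 1)}
    (le_of_hom (ULift.{w} (Fin 2 × Fin 2)) g), rfl⟩⟩

instance ulIncl_faithful : ulIncl.{w}.toFunctor.Faithful := ⟨fun _ => Subsingleton.elim _ _⟩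

instance lrIncl_full : lrIncl.{w}.toFunctor.Full :=
  ⟨fun g => ⟨leHom {x : ULift.{w} (Fin 2 × Fin 2) // x.down ≠ (0, 0)}
    (le_of_hom (ULift.{w} (Fin 2 × Fin 2)) g), rfl⟩⟩

instance lrIncl_faithful : lrIncl.{w}.toFunctor.Faithful := ⟨fun _ => Subsingleton.elim _ _⟩

instance prodRes_full {A E : Cat.{w, w}} (r : A ⟶ E) [r.toFunctor.Full] (B : Cat.{w, w}) :
    (prodRes r B).toFunctor.Full :=
  ⟨fun g => ⟨(r.toFunctor.preimage g.1, g.2), Prod.ext (r.toFunctor.map_preimage _) rfl⟩⟩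

instance prodRes_faithful {A E : Cat.{w, w}} (r : A ⟶ E) [r.toFunctor.Faithful] (B : Cat.{w, w}) :
    (prodRes r B).toFunctor.Faithful :=
  ⟨fun {_ _ _ _} e => Prod.ext (r.toFunctor.map_injective (congrArg Prod.fst e))
    (congrArg Prod.snd e :)⟩

/-! ### Cocartesian and cartesian squares as colimit and limit conditions -/

/-- The upper left corner as a diagram in the slice category over `(1, 1)`. -/
def ulSection : ulCorner.{w} ⟶ overSlice ulIncl lowerRight.{w} :=
  Functor.toCatHom
    { obj := fun x => Comma.mk (L := ulIncl.{w}.toFunctor)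
        (R := Functor.fromPUnit.{w} lowerRight.{w})
        x ⟨⟨⟩⟩ (ulCocone.toNatTrans.app x)
      map := fun g => ⟨g, 𝟙 _, Subsingleton.elim _ _⟩
      map_id := fun _ => rfl
      map_comp := fun _ _ => rfl }

/-- The projection from the slice over `(1, 1)` to the upper left corner is left adjoint to the
section. -/
def ulAdjunction : (overProj ulIncl lowerRight.{w}).toFunctor ⊣
    ulSection.{w}.toFunctor :=
  adjunctionOfSubsingleton _ _ (fun _ _ => inferInstance)
    (fun _ _ => ⟨fun _ _ => CommaMorphism.ext (Subsingleton.elim _ _)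
      (Subsingleton.elim (α := ULift (PLift _)) _ _)⟩)
    (fun _ _ g => ⟨g, 𝟙 _, Subsingleton.elim _ _⟩)
    (fun _ _ g => g.left)

/-- Only `(1, 1)` lies outside the corner, and the corner maps into the slice over it by a right
adjoint, which is final. -/
theorem isCocartesian_iff (hD : IsDerivator D) (X : D.Diag commSquare.{w}) :
    IsCocartesian D X ↔ IsColim D ulCocone X := by
  unfold IsCocartesian
  rw [exists_lan_essImage_iff ulIncl hD, isUniv_id_iff_of_cover ulIncl hD
    (fun b => b = lowerRight) (fun b hb => ⟨⟨b, fun h => hb (ULift.ext _ _ h)⟩, rfl⟩), forall_eq,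
    ← isColim_comp_iff ulAdjunction]
  exact Iff.rfl

/-- The lower right corner as a diagram in the slice category under `(0, 0)`. -/
def lrSection : lrCorner.{w} ⟶ underSlice lrIncl upperLeft.{w} :=
  Functor.toCatHom
    { obj := fun x => Comma.mk (R := lrIncl.{w}.toFunctor)
        (L := Functor.fromPUnit.{w} upperLeft.{w})
        ⟨⟨⟩⟩ x (lrCone.toNatTrans.app x)
      map := fun g => ⟨𝟙 _, g, Subsingleton.elim _ _⟩
      map_id := fun _ => rfl
      map_comp := fun _ _ => rfl }

/-- The projection from the slice under `(0, 0)` to the lower right corner is right adjoint to the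
section. -/
def lrAdjunction : lrSection.{w}.toFunctor ⊣
    (underProj lrIncl upperLeft.{w}).toFunctor :=
  adjunctionOfSubsingleton _ _
    (fun _ _ => ⟨fun _ _ => CommaMorphism.ext
      (Subsingleton.elim (α := ULift (PLift _)) _ _) (Subsingleton.elim _ _)⟩)
    (fun _ _ => inferInstance)
    (fun _ _ g => g.right)
    (fun _ _ g => ⟨𝟙 _, g, Subsingleton.elim _ _⟩)

theorem isCartesian_iff (hD : IsDerivator D) (X : D.Diag commSquare.{w}) :
    IsCartesian D X ↔ IsLim D lrCone X := by
  unfold IsCartesian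
  rw [exists_ran_essImage_iff lrIncl hD, isCouniv_id_iff_of_cover lrIncl hD
    (fun b => b = upperLeft) (fun b hb => ⟨⟨b, fun h => hb (ULift.ext _ _ h)⟩, rfl⟩), forall_eq,
    ← isLim_comp_iff lrAdjunction]
  exact Iff.rfl

/-- An invertible 2-cell of small categories, given by its components. -/
def isoOfComponents {A B : Cat.{w, w}} {f g : A ⟶ B}
    (e : ∀ a, f.toFunctor.obj a ≅ g.toFunctor.obj a)
    (h : ∀ {a a' : A} (x : a ⟶ a'),
      f.toFunctor.map x ≫ (e a').hom = (e a).hom ≫ g.toFunctor.map x) : f ≅ g :=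
  Cat.Hom.isoMk (NatIso.ofComponents e h)

theorem cat_hom₂_ext {A B : Cat.{v, u}} {f g : A ⟶ B} {α β : f ⟶ g}
    (h : ∀ a, α.toNatTrans.app a = β.toNatTrans.app a) : α = β :=
  Cat.Hom₂.ext (NatTrans.ext (funext h))

/-- The vertices of the upper left corner. -/
abbrev Ul : Type w := {x : ULift.{w} (Fin 2 × Fin 2) // x.down ≠ (1, 1)}

/-- The vertices of the lower right corner. -/
abbrev Lr : Type w := {x : ULift.{w} (Fin 2 × Fin 2) // x.down ≠ (0, 0)}

/-! ### Detection of squares in a poset with parameters -/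

section Corner

variable {P' P : Type w} [Preorder P'] [Preorder P] (r : P' →o P) {B : Cat.{w, w}} (b : B)
  (s : ULift.{w} (Fin 2 × Fin 2) →o P)

section Left

variable (k : Ul →o P') (hk : ∀ j, r (k j) = s j.1)

theorem ul_le (j : Ul) : s j.1 ≤ s ⟨(1, 1)⟩ :=
  s.monotone ⟨Fin.le_last _, Fin.le_last _⟩

/-- The corner of the square `s`, as a diagram in the slice over its vertex. -/
def ulToSlice : ulCorner.{w} ⟶
    overSlice (prodRes (ordFun r) B) ((s ⟨(1, 1)⟩, b) : Cat.of (Cat.of P × B)) :=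
  Functor.toCatHom
    { obj := fun j => Comma.mk (L := (prodRes (ordFun r) B).toFunctor)
        (R := Functor.fromPUnit.{w} ((s ⟨(1, 1)⟩, b) : Cat.of (Cat.of P × B)))
        (k j, b) ⟨⟨⟩⟩ (leHom P ((hk j).trans_le (ul_le s j)), 𝟙 b)
      map := fun g => ⟨(leHom P' (k.monotone (le_of_hom Ul g)), 𝟙 b), 𝟙 _,
        Prod.ext (Subsingleton.elim _ _) rfl⟩
      map_id := fun _ => rfl
      map_comp := fun _ _ => CommaMorphism.ext
        (Prod.ext (Subsingleton.elim _ _) (Category.id_comp _).symm) rfl }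

variable (ρ : P' → Ul) (hρ : ∀ p, r p ≤ s ⟨(1, 1)⟩ → ∀ j, ρ p ≤ j ↔ p ≤ k j)

/-- The reflection of the slice over the vertex of a square onto its corner. -/
def ulReflection :
    overSlice (prodRes (ordFun r) B) ((s ⟨(1, 1)⟩, b) : Cat.of (Cat.of P × B)) ⟶ ulCorner.{w} :=
  Functor.toCatHom
    { obj := fun x => ρ x.left.1
      map := fun {x y} g => leHom Ul ((hρ _ (le_of_hom P x.hom.1) _).2
        ((le_of_hom P' g.left.1).trans ((hρ _ (le_of_hom P y.hom.1) _).1 le_rfl)))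
      map_id := fun _ => Subsingleton.elim _ _
      map_comp := fun _ _ => Subsingleton.elim _ _ }

/-- The reflection is left adjoint to the inclusion. -/
def ulReflectionAdjunction :
    (ulReflection r b s k ρ hρ).toFunctor ⊣ (ulToSlice r b s k hk).toFunctor :=
  adjunctionOfSubsingleton _ _
    (fun _ _ => subsingleton_hom_of_preorder (P := Ul) _ _)
    (fun _ _ => ⟨fun g h => CommaMorphism.ext
      (Prod.ext (subsingleton_hom_of_preorder (P := P') _ _ |>.elim _ _)
        (((Category.comp_id _).symm.trans
          ((congrArg Prod.snd g.w).trans (congrArg Prod.snd h.w).symm)).trans (Category.comp_id _)))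
      (Subsingleton.elim (α := ULift (PLift _)) _ _)⟩)
    (fun X _ g => ⟨(leHom P' ((hρ _ (le_of_hom P X.hom.1) _).1 (le_of_hom Ul g)), X.hom.2), 𝟙 _,
      Prod.ext (subsingleton_hom_of_preorder (P := P) _ _ |>.elim _ _)
        ((Category.comp_id X.hom.2).trans (Category.comp_id X.hom.2).symm)⟩)
    (fun X _ g => leHom Ul ((hρ _ (le_of_hom P X.hom.1) _).2 (le_of_hom P' g.left.1)))

-- The map `ρ` is left adjoint to `k` below the new vertex. The corner is therefore reflective in
-- the slice, even with the parameter `B` present: the slice component in `B` supplies the arrow to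
-- `b`. Finality then replaces the slice by the corner.
include ρ hρ hk in
theorem isColim_overTrans_iff_isCocartesian (hD : IsDerivator D)
    (X : D.Diag (Cat.of (Cat.of P × B))) :
    IsColim D (overTrans (prodRes (ordFun r) B) ((s ⟨(1, 1)⟩, b) : Cat.of (Cat.of P × B))) X ↔
      IsCocartesian D ((D.res (atPoint (ordFun s) b)).obj X) := by
  rw [isCocartesian_iff hD, isColim_res_iff,
    ← isColim_comp_iff (ulReflectionAdjunction r b s k hk ρ hρ)]
  refine isColim_congr (q := toPt ulCorner)
    (isoOfComponents (fun j => ⟨(leHom P (hk j).le, 𝟙 b), (leHom P (hk j).ge, 𝟙 b),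
      Prod.ext (Subsingleton.elim _ _) (Category.id_comp _),
      Prod.ext (Subsingleton.elim _ _) (Category.id_comp _)⟩) ?_)
    (isoOfComponents (fun j => Iso.refl _) ?_) ?_ X
  · intro i j g
    exact Prod.ext (Subsingleton.elim _ _) rfl
  · intro i j g
    exact Prod.ext (Subsingleton.elim _ _) rfl
  · apply cat_hom₂_ext
    intro j
    refine Prod.ext (Subsingleton.elim _ _) ?_
    change (𝟙 b ≫ 𝟙 b) ≫ 𝟙 b = 𝟙 b ≫ 𝟙 b ≫ 𝟙 b
    simp

end Left

section Right

variable (k : Lr →o P') (hk : ∀ j, r (k j) = s j.1)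

theorem le_lr (j : Lr) : s ⟨(0, 0)⟩ ≤ s j.1 :=
  s.monotone ⟨Fin.zero_le _, Fin.zero_le _⟩

/-- The corner of the square `s`, as a diagram in the slice under its vertex. -/
def lrToSlice : lrCorner.{w} ⟶
    underSlice (prodRes (ordFun r) B) ((s ⟨(0, 0)⟩, b) : Cat.of (Cat.of P × B)) :=
  Functor.toCatHom
    { obj := fun j => Comma.mk (R := (prodRes (ordFun r) B).toFunctor)
        (L := Functor.fromPUnit.{w} ((s ⟨(0, 0)⟩, b) : Cat.of (Cat.of P × B)))
        ⟨⟨⟩⟩ (k j, b) (leHom P ((le_lr s j).trans_eq (hk j).symm), 𝟙 b)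
      map := fun g => ⟨𝟙 _, (leHom P' (k.monotone (le_of_hom Lr g)), 𝟙 b),
        Prod.ext (Subsingleton.elim _ _) rfl⟩
      map_id := fun _ => rfl
      map_comp := fun _ _ => CommaMorphism.ext rfl
        (Prod.ext (Subsingleton.elim _ _) (Category.id_comp _).symm) }

variable (ρ : P' → Lr) (hρ : ∀ p, s ⟨(0, 0)⟩ ≤ r p → ∀ j, j ≤ ρ p ↔ k j ≤ p)

/-- The coreflection of the slice under the vertex of a square onto its corner. -/
def lrCoreflection :
    underSlice (prodRes (ordFun r) B) ((s ⟨(0, 0)⟩, b) : Cat.of (Cat.of P × B)) ⟶ lrCorner.{w} :=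
  Functor.toCatHom
    { obj := fun x => ρ x.right.1
      map := fun {x y} g => leHom Lr ((hρ _ (le_of_hom P y.hom.1) _).2
        (((hρ _ (le_of_hom P x.hom.1) _).1 le_rfl).trans (le_of_hom P' g.right.1)))
      map_id := fun _ => Subsingleton.elim _ _
      map_comp := fun _ _ => Subsingleton.elim _ _ }

/-- The coreflection is right adjoint to the inclusion. -/
def lrCoreflectionAdjunction :
    (lrToSlice r b s k hk).toFunctor ⊣ (lrCoreflection r b s k ρ hρ).toFunctor :=
  adjunctionOfSubsingleton _ _
    (fun _ _ => ⟨fun g h => CommaMorphism.ext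
      (Subsingleton.elim (α := ULift (PLift _)) _ _)
      (Prod.ext (subsingleton_hom_of_preorder (P := P') _ _ |>.elim _ _)
        (((Category.id_comp _).symm.trans
          ((congrArg Prod.snd g.w).symm.trans (congrArg Prod.snd h.w))).trans
            (Category.id_comp _)))⟩)
    (fun _ _ => subsingleton_hom_of_preorder (P := Lr) _ _)
    (fun _ Y g => leHom Lr ((hρ _ (le_of_hom P Y.hom.1) _).2 (le_of_hom P' g.right.1)))
    (fun _ Y g => ⟨𝟙 _, (leHom P' ((hρ _ (le_of_hom P Y.hom.1) _).1 (le_of_hom Lr g)), Y.hom.2),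
      Prod.ext (subsingleton_hom_of_preorder (P := P) _ _ |>.elim _ _)
        ((Category.id_comp Y.hom.2).trans (Category.id_comp Y.hom.2).symm)⟩)

include ρ hρ hk in
theorem isLim_underTrans_iff_isCartesian (hD : IsDerivator D)
    (X : D.Diag (Cat.of (Cat.of P × B))) :
    IsLim D (underTrans (prodRes (ordFun r) B) ((s ⟨(0, 0)⟩, b) : Cat.of (Cat.of P × B))) X ↔
      IsCartesian D ((D.res (atPoint (ordFun s) b)).obj X) := by
  rw [isCartesian_iff hD, isLim_res_iff,
    ← isLim_comp_iff (lrCoreflectionAdjunction r b s k hk ρ hρ)]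
  refine isLim_congr (q := toPt lrCorner)
    (isoOfComponents (fun j => ⟨(leHom P (hk j).le, 𝟙 b), (leHom P (hk j).ge, 𝟙 b),
      Prod.ext (Subsingleton.elim _ _) (Category.id_comp _),
      Prod.ext (Subsingleton.elim _ _) (Category.id_comp _)⟩) ?_)
    (isoOfComponents (fun j => Iso.refl _) ?_) ?_ X
  · intro i j g
    exact Prod.ext (Subsingleton.elim _ _) rfl
  · intro i j g
    exact Prod.ext (Subsingleton.elim _ _) rfl
  · apply cat_hom₂_ext
    intro j
    refine Prod.ext (Subsingleton.elim _ _) ?_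
    change (𝟙 b ≫ 𝟙 b) ≫ 𝟙 b = 𝟙 b ≫ 𝟙 b ≫ 𝟙 b
    simp

end Right

end Corner

/-! ### Colimits of empty diagrams -/

/-- The empty category. -/
abbrev emptyCat : Cat.{w, w} := Cat.of (Σ i : PEmpty.{w + 1}, (PEmpty.elim i : Cat.{w, w}))

/-- (Der1) for the empty family: the diagrams of empty shape are equivalent to an empty product. -/
theorem unique_hom_emptyCat (hD : IsDerivator D) (X Y : D.Diag emptyCat.{w}) :
    Nonempty (Unique (X ⟶ Y)) := by
  have := hD.der1 (fun i : PEmpty.{w + 1} => (PEmpty.elim i : Cat.{w, w}))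
  let F := coprodComparison D (fun i : PEmpty.{w + 1} => (PEmpty.elim i : Cat.{w, w}))
  exact ⟨⟨⟨F.preimage (X := X) (Y := Y) fun i => i.elim⟩, fun f =>
    F.map_injective (funext fun i => i.elim)⟩⟩

theorem bijective_of_unique {α β : Type*} (hβ : Nonempty (Unique β)) (f : α → β) :
    Function.Bijective f ↔ Nonempty (Unique α) := by
  obtain ⟨_⟩ := hβ
  constructor
  · intro h
    exact ⟨(Equiv.ofBijective f h).unique⟩
  · rintro ⟨_⟩
    exact ⟨fun _ _ _ => Subsingleton.elim _ _, fun b => ⟨default, Subsingleton.elim _ _⟩⟩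

section

variable {J P : Cat.{w, w}} [IsEmpty J]

/-- An empty category admits a functor to any category. -/
def ofEmpty (J K : Cat.{w, w}) [IsEmpty J] : J ⟶ K :=
  Functor.toCatHom (C := J) (D := K)
    { obj := fun x => isEmptyElim x
      map := fun {x} => isEmptyElim x
      map_id := fun x => isEmptyElim x
      map_comp := fun {x} => isEmptyElim x }

instance : IsEmpty emptyCat.{w} := ⟨fun x => x.1.elim⟩

/-- Functors between empty categories are adjoint. -/
def emptyAdjunction (J K : Cat.{w, w}) [IsEmpty J] [IsEmpty K] :
    (ofEmpty J K).toFunctor ⊣ (ofEmpty K J).toFunctor :=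
  adjunctionOfSubsingleton _ _ (fun x => isEmptyElim x) (fun x => isEmptyElim x)
    (fun x => isEmptyElim x) (fun x => isEmptyElim x)

/-- After transport to `emptyCat` the target of the universal bijection is a one-element set, so the
condition says that the source is one too. -/
theorem isColim_iff_of_isEmpty (hD : IsDerivator D) {g : J ⟶ P} {q : J ⟶ pt.{w}}
    {v : pt.{w} ⟶ P} (c : g ⟶ q ≫ v) (X : D.Diag P) :
    IsColim D c X ↔ ∀ Z, Nonempty (Unique ((D.res v).obj X ⟶ Z)) := by
  unfold IsColim
  rw [← isUniv_res_map_iff (emptyAdjunction J emptyCat.{w})]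
  exact forall_congr' fun Z => bijective_of_unique (unique_hom_emptyCat hD _ _) _

theorem isLim_iff_of_isEmpty (hD : IsDerivator D) {g : J ⟶ P} {q : J ⟶ pt.{w}}
    {v : pt.{w} ⟶ P} (c : q ≫ v ⟶ g) (X : D.Diag P) :
    IsLim D c X ↔ ∀ Z, Nonempty (Unique (Z ⟶ (D.res v).obj X)) := by
  unfold IsLim
  rw [← isCouniv_res_map_iff (emptyAdjunction emptyCat.{w} J)]
  exact forall_congr' fun Z => bijective_of_unique (unique_hom_emptyCat hD _ _) _

end

/-- An initial object is isomorphic to the given zero object. Pointedness thereby turns extensions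
over empty slices into extensions by zero. -/
theorem isZero_iff_unique_from {C : Type*} [Category* C] (h : HasZeroObject C) (X : C) :
    IsZero X ↔ ∀ Z, Nonempty (Unique (X ⟶ Z)) := by
  refine ⟨fun h Z => h.unique_to Z, fun hX => ?_⟩
  obtain ⟨O, hO⟩ := h
  obtain ⟨⟨⟨f⟩, _⟩⟩ := hX O
  obtain ⟨⟨⟨g⟩, _⟩⟩ := hO.unique_to X
  obtain ⟨_⟩ := hX X
  exact hO.of_iso ⟨f, g, Subsingleton.elim _ _, hO.eq_of_src _ _⟩

theorem isZero_iff_unique_to {C : Type*} [Category* C] (h : HasZeroObject C) (X : C) :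
    IsZero X ↔ ∀ Z, Nonempty (Unique (Z ⟶ X)) := by
  refine ⟨fun h Z => h.unique_from Z, fun hX => ?_⟩
  obtain ⟨O, hO⟩ := h
  obtain ⟨⟨⟨f⟩, _⟩⟩ := hX O
  obtain ⟨⟨⟨g⟩, _⟩⟩ := hO.unique_from X
  obtain ⟨_⟩ := hX X
  exact hO.of_iso ⟨g, f, Subsingleton.elim _ _, hO.eq_of_src _ _⟩

/-! ### Functors restricting to equivalences of full subcategories -/

section

universe v₁ v₂ v₃ u₁ u₂ u₃

variable {C : Type u₁} [Category.{v₁} C] {C' : Type u₂} [Category.{v₂} C']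
  {C'' : Type u₃} [Category.{v₃} C'']

/-- The functor `G` restricts to an equivalence between the full subcategories on the objects
satisfying `Q` and `Q'`. -/
structure RestrictsToEquiv (G : C ⥤ C') (Q : C → Prop) (Q' : C' → Prop) : Prop where
  map_obj (X : C) : Q X → Q' (G.obj X)
  bijective (X Y : C) : Q X → Q Y → Function.Bijective (G.map : (X ⟶ Y) → _)
  surjective (Y : C') : Q' Y → ∃ X, Q X ∧ Nonempty (G.obj X ≅ Y)

theorem RestrictsToEquiv.comp {G : C ⥤ C'} {G' : C' ⥤ C''} {Q : C → Prop} {Q' : C' → Prop}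
    {Q'' : C'' → Prop} (h : RestrictsToEquiv G Q Q') (h' : RestrictsToEquiv G' Q' Q'') :
    RestrictsToEquiv (G ⋙ G') Q Q'' where
  map_obj X hX := h'.map_obj _ (h.map_obj X hX)
  bijective X Y hX hY := (h'.bijective _ _ (h.map_obj X hX) (h.map_obj Y hY)).comp
    (h.bijective X Y hX hY)
  surjective Z hZ := by
    obtain ⟨Y, hY, ⟨e⟩⟩ := h'.surjective Z hZ
    obtain ⟨X, hX, ⟨e'⟩⟩ := h.surjective Y hY
    exact ⟨X, hX, ⟨G'.mapIso e' ≪≫ e⟩⟩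

theorem RestrictsToEquiv.congr {G G' : C ⥤ C'} {Q Q₂ : C → Prop}
    (h : RestrictsToEquiv G Q fun _ => True) (e : G ≅ G') (hQ : ∀ X, Q X ↔ Q₂ X) :
    RestrictsToEquiv G' Q₂ fun _ => True where
  map_obj _ _ := trivial
  bijective X Y hX hY := by
    have h1 := h.bijective X Y ((hQ X).2 hX) ((hQ Y).2 hY)
    have : (G'.map : (X ⟶ Y) → _) = (fun f => e.inv.app X ≫ f) ∘ (fun f => f ≫ e.hom.app Y) ∘
        G.map := by
      funext f
      simp
    rw [this]
    exact (bijective_comp_left _).comp ((bijective_comp_right _).comp h1)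
  surjective Y _ := by
    obtain ⟨X, hX, ⟨i⟩⟩ := h.surjective Y trivial
    exact ⟨X, (hQ X).1 hX, ⟨(e.app X).symm ≪≫ i⟩⟩

end

/-- A coherent square that is both cocartesian and cartesian. -/
def IsBicartesian (D : Prederivator.{w, v, u}) (X : D.Diag commSquare.{w}) : Prop :=
  IsCocartesian D X ∧ IsCartesian D X

/-- Here stability enters: a vertex added as a pushout and a vertex added as a pullback impose the
same condition on the square, so an extension can be read from either end. -/
theorem IsStableDerivator.isBicartesian_iff_isCocartesian (hD : IsStableDerivator D)
    (X : D.Diag commSquare.{w}) : IsBicartesian D X ↔ IsCocartesian D X :=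
  and_iff_left_of_imp (hD.cocartesian_iff_cartesian X).1

theorem IsStableDerivator.isBicartesian_iff_isCartesian (hD : IsStableDerivator D)
    (X : D.Diag commSquare.{w}) : IsBicartesian D X ↔ IsCartesian D X :=
  and_iff_right_of_imp (hD.cocartesian_iff_cartesian X).2

theorem IsCocartesian.of_iso {X Y : D.Diag commSquare.{w}} (e : X ≅ Y) (h : IsCocartesian D X) :
    IsCocartesian D Y := by
  obtain ⟨lan, adj, Z, ⟨i⟩⟩ := h
  exact ⟨lan, adj, Z, ⟨i ≪≫ e⟩⟩

theorem IsCartesian.of_iso {X Y : D.Diag commSquare.{w}} (e : X ≅ Y) (h : IsCartesian D X) :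
    IsCartesian D Y := by
  obtain ⟨ran, adj, Z, ⟨i⟩⟩ := h
  exact ⟨ran, adj, Z, ⟨i ≪≫ e⟩⟩

theorem IsBicartesian.of_iso {X Y : D.Diag commSquare.{w}} (e : X ≅ Y) (h : IsBicartesian D X) :
    IsBicartesian D Y :=
  ⟨h.1.of_iso e, h.2.of_iso e⟩

/-! ### Pointwise conditions on diagrams with parameters -/

section Conditions

variable {A E B : Cat.{w, w}}

/-- The square `s` of a diagram with parameters in `B` is bicartesian for each value of the
parameter. -/
def SquareCondition (s : commSquare ⟶ E) (X : D.Diag (Cat.of (E × B))) : Prop :=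
  ∀ b : B, IsBicartesian D ((D.res (atPoint s b)).obj X)

/-- The value of a diagram with parameters in `B` at `o` vanishes for each value of the
parameter. -/
def ZeroCondition (o : E) (X : D.Diag (Cat.of (E × B))) : Prop :=
  ∀ b : B, IsZero ((D.res (pick ((o, b) : Cat.of (E × B)))).obj X)

theorem SquareCondition.of_iso {s : commSquare ⟶ E} {X Y : D.Diag (Cat.of (E × B))} (e : X ≅ Y)
    (h : SquareCondition s X) : SquareCondition s Y :=
  fun b => (h b).of_iso ((D.res _).mapIso e)

theorem ZeroCondition.of_iso {o : E} {X Y : D.Diag (Cat.of (E × B))} (e : X ≅ Y)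
    (h : ZeroCondition o X) : ZeroCondition o Y :=
  fun b => (h b).of_iso ((D.res _).mapIso e.symm)

theorem squareCondition_res_iff (s : commSquare ⟶ A) (r : A ⟶ E) (X : D.Diag (Cat.of (E × B))) :
    SquareCondition s ((D.res (prodRes r B)).obj X) ↔ SquareCondition (s ≫ r) X := by
  refine forall_congr' fun b => ?_
  have e : (D.res (atPoint (s ≫ r) b)).obj X ≅
    (D.res (atPoint s b)).obj ((D.res (prodRes r B)).obj X) :=
    (D.resComp (atPoint s b) (prodRes r B)).app X
  exact ⟨fun h => h.of_iso e.symm, fun h => h.of_iso e⟩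

theorem zeroCondition_res_iff (o : A) (r : A ⟶ E) (X : D.Diag (Cat.of (E × B))) :
    ZeroCondition o ((D.res (prodRes r B)).obj X) ↔ ZeroCondition (r.toFunctor.obj o) X := by
  refine forall_congr' fun b => ?_
  have i : pick ((r.toFunctor.obj o, b) : Cat.of (E × B)) ≅
      pick ((o, b) : Cat.of (A × B)) ≫ prodRes r B :=
    isoOfComponents (fun _ => Iso.refl _) fun _ => by
      refine (Category.comp_id _).trans (Eq.trans ?_ (Category.id_comp _).symm)
      exact ((prodRes r B).toFunctor.map_id (o, b)).symm
  have e : (D.res (pick ((r.toFunctor.obj o, b) : Cat.of (E × B)))).obj X ≅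
      (D.res (pick ((o, b) : Cat.of (A × B)))).obj ((D.res (prodRes r B)).obj X) :=
    (D.resIso i).app X ≪≫ (D.resComp (pick ((o, b) : Cat.of (A × B))) (prodRes r B)).app X
  exact ⟨fun h => h.of_iso e, fun h => h.of_iso e.symm⟩

theorem squareCondition_map (s : commSquare ⟶ E) {B' : Cat.{w, w}} (f : B' ⟶ B)
    (X : D.Diag (Cat.of (E × B))) (h : SquareCondition s X) :
    SquareCondition s ((D.res (prodMap E f)).obj X) := by
  intro b
  have i : atPoint s (f.toFunctor.obj b) ≅ atPoint s b ≫ prodMap E f :=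
    isoOfComponents (fun _ => Iso.refl _) fun _ => by
      refine (Category.comp_id _).trans (Eq.trans ?_ (Category.id_comp _).symm)
      exact Prod.ext rfl (f.toFunctor.map_id b).symm
  exact (h (f.toFunctor.obj b)).of_iso ((D.resIso i).app X ≪≫ (D.resComp _ _).app X)

theorem zeroCondition_map (o : E) {B' : Cat.{w, w}} (f : B' ⟶ B)
    (X : D.Diag (Cat.of (E × B))) (h : ZeroCondition o X) :
    ZeroCondition o ((D.res (prodMap E f)).obj X) := by
  intro b
  have i : pick ((o, f.toFunctor.obj b) : Cat.of (E × B)) ≅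
      pick ((o, b) : Cat.of (E × B')) ≫ prodMap E f :=
    isoOfComponents (fun _ => Iso.refl _) fun _ => by
      refine (Category.comp_id _).trans (Eq.trans ?_ (Category.id_comp _).symm)
      exact ((prodMap E f).toFunctor.map_id (o, b)).symm
  exact (h (f.toFunctor.obj b)).of_iso ((D.resIso i).app X ≪≫ (D.resComp _ _).app X).symm

end Conditions

/-! ### Extension of diagrams by one vertex -/

section Steps

variable {A B : Cat.{w, w}} (f : A ⟶ B) [f.toFunctor.Full] [f.toFunctor.Faithful]

/-- Universality of the identity at `X` is exactly bijectivity of restriction on arrows out of `X`.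
Surjectivity comes from `exists_lan`. -/
theorem restrictsToEquiv_of_lan (hD : IsDerivator D) (Q : D.Diag B → Prop) (Q' : D.Diag A → Prop)
    (hQ' : ∀ X Y, (X ≅ Y) → Q' X → Q' Y)
    (hQ : ∀ X, IsUniv (D.res f) (𝟙 ((D.res f).obj X)) ↔ Q X) :
    RestrictsToEquiv (D.res f) (fun X => Q' ((D.res f).obj X) ∧ Q X) Q' where
  map_obj X hX := hX.1
  bijective X Y hX _ := by
    have := (hQ X).2 hX.2 Y
    simpa using this
  surjective Y hY := by
    obtain ⟨X, hX, ⟨e⟩⟩ := exists_lan f hD Y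
    exact ⟨X, ⟨hQ' _ _ e.symm hY, (hQ X).1 hX⟩, ⟨e⟩⟩

theorem restrictsToEquiv_of_ran (hD : IsDerivator D) (Q : D.Diag B → Prop) (Q' : D.Diag A → Prop)
    (hQ' : ∀ X Y, (X ≅ Y) → Q' X → Q' Y)
    (hQ : ∀ X, IsCouniv (D.res f) (𝟙 ((D.res f).obj X)) ↔ Q X) :
    RestrictsToEquiv (D.res f) (fun X => Q' ((D.res f).obj X) ∧ Q X) Q' where
  map_obj X hX := hX.1
  bijective X Y _ hY := by
    have := (hQ Y).2 hY.2 X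
    simpa using this
  surjective Y hY := by
    obtain ⟨X, hX, ⟨e⟩⟩ := exists_ran f hD Y
    exact ⟨X, ⟨hQ' _ _ e.symm hY, (hQ X).1 hX⟩, ⟨e⟩⟩

end Steps

section PosetSteps

variable {P' P : Type w} [Preorder P'] [Preorder P] (r : P' ↪o P) (B : Cat.{w, w})
  {Q' : D.Diag (Cat.of (Cat.of P' × B)) → Prop}

theorem restrictsToEquiv_add_pushout (hD : IsStableDerivator D)
    (hQ' : ∀ X Y, (X ≅ Y) → Q' X → Q' Y) (s : ULift.{w} (Fin 2 × Fin 2) →o P)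
    (hs : ∀ p, p ≠ s ⟨(1, 1)⟩ → ∃ p', r p' = p) (k : Ul →o P') (hk : ∀ j, r (k j) = s j.1)
    (ρ : P' → Ul) (hρ : ∀ p, r p ≤ s ⟨(1, 1)⟩ → ∀ j, ρ p ≤ j ↔ p ≤ k j) :
    RestrictsToEquiv (D.res (prodRes (ordFun r.toOrderHom) B))
      (fun X => Q' ((D.res (prodRes (ordFun r.toOrderHom) B)).obj X) ∧
        SquareCondition (ordFun s) X) Q' := by
  refine restrictsToEquiv_of_lan _ hD.toIsDerivator _ Q' hQ' fun X => ?_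
  rw [isUniv_id_iff_of_cover _ hD.toIsDerivator (fun x : P × B => x.1 = s ⟨(1, 1)⟩)]
  · constructor
    · intro h b
      exact (hD.isBicartesian_iff_isCocartesian _).2
        ((isColim_overTrans_iff_isCocartesian r.toOrderHom b s k hk ρ hρ hD.toIsDerivator X).1
          (h (s ⟨(1, 1)⟩, b) rfl))
    · rintro h ⟨_, b⟩ rfl
      exact (isColim_overTrans_iff_isCocartesian r.toOrderHom b s k hk ρ hρ hD.toIsDerivator X).2
        ((hD.isBicartesian_iff_isCocartesian _).1 (h b))
  · rintro ⟨p, b⟩ hp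
    obtain ⟨p', rfl⟩ := hs p hp
    exact ⟨(p', b), rfl⟩

theorem restrictsToEquiv_add_pullback (hD : IsStableDerivator D)
    (hQ' : ∀ X Y, (X ≅ Y) → Q' X → Q' Y) (s : ULift.{w} (Fin 2 × Fin 2) →o P)
    (hs : ∀ p, p ≠ s ⟨(0, 0)⟩ → ∃ p', r p' = p) (k : Lr →o P') (hk : ∀ j, r (k j) = s j.1)
    (ρ : P' → Lr) (hρ : ∀ p, s ⟨(0, 0)⟩ ≤ r p → ∀ j, j ≤ ρ p ↔ k j ≤ p) :
    RestrictsToEquiv (D.res (prodRes (ordFun r.toOrderHom) B))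
      (fun X => Q' ((D.res (prodRes (ordFun r.toOrderHom) B)).obj X) ∧
        SquareCondition (ordFun s) X) Q' := by
  refine restrictsToEquiv_of_ran _ hD.toIsDerivator _ Q' hQ' fun X => ?_
  rw [isCouniv_id_iff_of_cover _ hD.toIsDerivator (fun x : P × B => x.1 = s ⟨(0, 0)⟩)]
  · constructor
    · intro h b
      exact (hD.isBicartesian_iff_isCartesian _).2
        ((isLim_underTrans_iff_isCartesian r.toOrderHom b s k hk ρ hρ hD.toIsDerivator X).1
          (h (s ⟨(0, 0)⟩, b) rfl))
    · rintro h ⟨_, b⟩ rfl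
      exact (isLim_underTrans_iff_isCartesian r.toOrderHom b s k hk ρ hρ hD.toIsDerivator X).2
        ((hD.isBicartesian_iff_isCartesian _).1 (h b))
  · rintro ⟨p, b⟩ hp
    obtain ⟨p', rfl⟩ := hs p hp
    exact ⟨(p', b), rfl⟩

/-- Nothing old lies below `o`, so the slices over `(o, b)` are empty and left Kan extension puts a
zero object there. -/
theorem restrictsToEquiv_add_initial (hD : IsStableDerivator D)
    (hQ' : ∀ X Y, (X ≅ Y) → Q' X → Q' Y) (o : P) (ho : ∀ p, p ≠ o → ∃ p', r p' = p)
    (hlt : ∀ p, ¬ r p ≤ o) :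
    RestrictsToEquiv (D.res (prodRes (ordFun r.toOrderHom) B))
      (fun X => Q' ((D.res (prodRes (ordFun r.toOrderHom) B)).obj X) ∧
        ZeroCondition (E := Cat.of P) o X) Q' := by
  refine restrictsToEquiv_of_lan _ hD.toIsDerivator _ Q' hQ' fun X => ?_
  have key (b : B) : IsColim D (overTrans (prodRes (ordFun r.toOrderHom) B)
      ((o, b) : Cat.of (Cat.of P × B))) X ↔
      IsZero ((D.res (pick ((o, b) : Cat.of (Cat.of P × B)))).obj X) := by
    have : IsEmpty (overSlice (prodRes (ordFun r.toOrderHom) B)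
        ((o, b) : Cat.of (Cat.of P × B))) := ⟨fun x => hlt _ (le_of_hom P x.hom.1)⟩
    rw [isColim_iff_of_isEmpty hD.toIsDerivator, ← isZero_iff_unique_from hD.pointed]
  rw [isUniv_id_iff_of_cover _ hD.toIsDerivator (fun x : P × B => x.1 = o)]
  · constructor
    · intro h b
      exact (key b).1 (h (o, b) rfl)
    · rintro h ⟨_, b⟩ rfl
      exact (key b).2 (h b)
  · rintro ⟨p, b⟩ hp
    obtain ⟨p', rfl⟩ := ho p hp
    exact ⟨(p', b), rfl⟩

theorem restrictsToEquiv_add_terminal (hD : IsStableDerivator D)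
    (hQ' : ∀ X Y, (X ≅ Y) → Q' X → Q' Y) (o : P) (ho : ∀ p, p ≠ o → ∃ p', r p' = p)
    (hlt : ∀ p, ¬ o ≤ r p) :
    RestrictsToEquiv (D.res (prodRes (ordFun r.toOrderHom) B))
      (fun X => Q' ((D.res (prodRes (ordFun r.toOrderHom) B)).obj X) ∧
        ZeroCondition (E := Cat.of P) o X) Q' := by
  refine restrictsToEquiv_of_ran _ hD.toIsDerivator _ Q' hQ' fun X => ?_
  have key (b : B) : IsLim D (underTrans (prodRes (ordFun r.toOrderHom) B)
      ((o, b) : Cat.of (Cat.of P × B))) X ↔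
      IsZero ((D.res (pick ((o, b) : Cat.of (Cat.of P × B)))).obj X) := by
    have : IsEmpty (underSlice (prodRes (ordFun r.toOrderHom) B)
        ((o, b) : Cat.of (Cat.of P × B))) := ⟨fun x => hlt _ (le_of_hom P x.hom.1)⟩
    rw [isLim_iff_of_isEmpty hD.toIsDerivator, ← isZero_iff_unique_to hD.pointed]
  rw [isCouniv_id_iff_of_cover _ hD.toIsDerivator (fun x : P × B => x.1 = o)]
  · constructor
    · intro h b
      exact (key b).1 (h (o, b) rfl)
    · rintro h ⟨_, b⟩ rfl
      exact (key b).2 (h b)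
  · rintro ⟨p, b⟩ hp
    obtain ⟨p', rfl⟩ := ho p hp
    exact ⟨(p', b), rfl⟩

end PosetSteps

/-! ### Extension of diagrams along an inclusion of posets -/

section Extensions

variable (D)

/-- Restriction along `r : P' ↪o P` identifies the diagrams on `P` that satisfy the condition `C`
with the diagrams on `P'`, and this is compatible with every condition on the latter. -/
def IsExtension {P' P : Type w} [Preorder P'] [Preorder P] (r : P' ↪o P)
    (C : ∀ B : Cat.{w, w}, D.Diag (Cat.of (Cat.of P × B)) → Prop) : Prop :=
  ∀ (B : Cat.{w, w}) (Q' : D.Diag (Cat.of (Cat.of P' × B)) → Prop),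
    (∀ X Y, (X ≅ Y) → Q' X → Q' Y) →
      RestrictsToEquiv (D.res (prodRes (ordFun r.toOrderHom) B))
        (fun X => Q' ((D.res (prodRes (ordFun r.toOrderHom) B)).obj X) ∧ C B X) Q'

variable {D} {P' P : Type w} [Preorder P'] [Preorder P]

/-- Replaces the data `k` and `ρ` by order-theoretic statements which `decide` can settle for
concrete finite posets. -/
theorem isExtension_pushout (hD : IsStableDerivator D) (r : P' ↪o P)
    (s : ULift.{w} (Fin 2 × Fin 2) →o P)
    (hr : ∀ p, (∃ p', r p' = p) ↔ p ≠ s ⟨(1, 1)⟩)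
    (hs : ∀ j : Fin 2 × Fin 2, j ≠ (1, 1) → s ⟨j⟩ ≠ s ⟨(1, 1)⟩)
    (hρ : ∀ p, p ≠ s ⟨(1, 1)⟩ → p ≤ s ⟨(1, 1)⟩ →
      ∃ i : Fin 2 × Fin 2, i ≠ (1, 1) ∧ ∀ j, j ≠ (1, 1) → (i ≤ j ↔ p ≤ s ⟨j⟩)) :
    IsExtension D r fun _ => SquareCondition (ordFun s) := by
  intro B Q' hQ'
  have hk (j : Ul) : ∃ p', r p' = s j.1 := (hr _).2 (hs _ j.2)
  choose k hk using hk
  have hρ' (p : P') : ∃ i : Ul, r p ≤ s ⟨(1, 1)⟩ → ∀ j, i ≤ j ↔ p ≤ k j := by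
    by_cases h : r p ≤ s ⟨(1, 1)⟩
    · obtain ⟨i, hi, hij⟩ := hρ (r p) ((hr _).1 ⟨p, rfl⟩) h
      refine ⟨⟨⟨i⟩, hi⟩, fun _ j => ?_⟩
      rw [← r.le_iff_le, hk]
      exact hij j.1.down j.2
    -- Elements that are not below the new vertex do not occur in the slice, so any value will do.
    · exact ⟨⟨⟨(0, 0)⟩, by decide⟩, fun h' => absurd h' h⟩
  choose ρ hρ' using hρ'
  exact restrictsToEquiv_add_pushout r B hD hQ' s (fun p => (hr p).2)
    ⟨k, fun i j hij => by rw [← r.le_iff_le, hk, hk]; exact s.monotone hij⟩ hk ρ hρ'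

theorem isExtension_pullback (hD : IsStableDerivator D) (r : P' ↪o P)
    (s : ULift.{w} (Fin 2 × Fin 2) →o P)
    (hr : ∀ p, (∃ p', r p' = p) ↔ p ≠ s ⟨(0, 0)⟩)
    (hs : ∀ j : Fin 2 × Fin 2, j ≠ (0, 0) → s ⟨j⟩ ≠ s ⟨(0, 0)⟩)
    (hρ : ∀ p, p ≠ s ⟨(0, 0)⟩ → s ⟨(0, 0)⟩ ≤ p →
      ∃ i : Fin 2 × Fin 2, i ≠ (0, 0) ∧ ∀ j, j ≠ (0, 0) → (j ≤ i ↔ s ⟨j⟩ ≤ p)) :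
    IsExtension D r fun _ => SquareCondition (ordFun s) := by
  intro B Q' hQ'
  have hk (j : Lr) : ∃ p', r p' = s j.1 := (hr _).2 (hs _ j.2)
  choose k hk using hk
  have hρ' (p : P') : ∃ i : Lr, s ⟨(0, 0)⟩ ≤ r p → ∀ j, j ≤ i ↔ k j ≤ p := by
    by_cases h : s ⟨(0, 0)⟩ ≤ r p
    · obtain ⟨i, hi, hij⟩ := hρ (r p) ((hr _).1 ⟨p, rfl⟩) h
      refine ⟨⟨⟨i⟩, hi⟩, fun _ j => ?_⟩
      rw [← r.le_iff_le, hk]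
      exact hij j.1.down j.2
    · exact ⟨⟨⟨(1, 1)⟩, by decide⟩, fun h' => absurd h' h⟩
  choose ρ hρ' using hρ'
  exact restrictsToEquiv_add_pullback r B hD hQ' s (fun p => (hr p).2)
    ⟨k, fun i j hij => by rw [← r.le_iff_le, hk, hk]; exact s.monotone hij⟩ hk ρ hρ'

theorem isExtension_initial (hD : IsStableDerivator D) (r : P' ↪o P) (o : P)
    (hr : ∀ p, (∃ p', r p' = p) ↔ p ≠ o) (ho : ∀ p, p ≠ o → ¬ p ≤ o) :
    IsExtension D r fun _ => ZeroCondition (E := Cat.of P) o :=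
  fun B _ hQ' => restrictsToEquiv_add_initial r B hD hQ' o (fun p => (hr p).2)
    fun p => ho _ ((hr _).1 ⟨p, rfl⟩)

theorem isExtension_terminal (hD : IsStableDerivator D) (r : P' ↪o P) (o : P)
    (hr : ∀ p, (∃ p', r p' = p) ↔ p ≠ o) (ho : ∀ p, p ≠ o → ¬ o ≤ p) :
    IsExtension D r fun _ => ZeroCondition (E := Cat.of P) o :=
  fun B _ hQ' => restrictsToEquiv_add_terminal r B hD hQ' o (fun p => (hr p).2)
    fun p => ho _ ((hr _).1 ⟨p, rfl⟩)

end Extensions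

/-! ### Shapes and their resolutions -/

/-- Two bicartesian squares and a vanishing condition on diagrams of shape `E`. -/
structure Shape (E : Cat.{w, w}) where
  square₁ : commSquare.{w} ⟶ E
  square₂ : commSquare.{w} ⟶ E
  zero : E

namespace Shape

variable {E : Cat.{w, w}} (σ : Shape E)

/-- The conditions of a shape, imposed for each value of the parameter in `B`. -/
structure Holds (D : Prederivator.{w, v, u}) (B : Cat.{w, w}) (X : D.Diag (Cat.of (E × B))) :
    Prop where
  square₁ : SquareCondition σ.square₁ X
  square₂ : SquareCondition σ.square₂ X
  zero : ZeroCondition σ.zero X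

/-- Diagrams of shape `A` are identified by restriction with the diagrams of shape `E` that satisfy
the conditions of `σ`. -/
def Resolves (A : Cat.{w, w}) (r : A ⟶ E) : Prop :=
  ∀ (D : Prederivator.{w, v, u}), IsStableDerivator D → ∀ B : Cat.{w, w},
    RestrictsToEquiv (D.res (prodRes r B)) (σ.Holds D B) fun _ => True

/-- Three one-vertex extensions, by a square, a zero and a square, are composed; the conditions
living on the intermediate posets are then read on `P`. -/
theorem resolves_of_isExtension {P₀ P₁ P₂ P : Type w} [Preorder P₀] [Preorder P₁] [Preorder P₂]
    [Preorder P] (σ : Shape (Cat.of P)) (r₁ : P₀ ↪o P₁) (r₂ : P₁ ↪o P₂) (r₃ : P₂ ↪o P)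
    (s₁ : ULift.{w} (Fin 2 × Fin 2) →o P₁) (s₂ : ULift.{w} (Fin 2 × Fin 2) →o P) (o : P₂)
    (h₁ : ∀ D : Prederivator.{w, v, u}, IsStableDerivator D →
      IsExtension D r₁ fun _ => SquareCondition (ordFun s₁))
    (h₂ : ∀ D : Prederivator.{w, v, u}, IsStableDerivator D →
      IsExtension D r₂ fun _ => ZeroCondition (E := Cat.of P₂) o)
    (h₃ : ∀ D : Prederivator.{w, v, u}, IsStableDerivator D →
      IsExtension D r₃ fun _ => SquareCondition (ordFun s₂))
    (hs₁ : σ.square₁ = ordFun ((r₃.toOrderHom.comp r₂.toOrderHom).comp s₁))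
    (hs₂ : σ.square₂ = ordFun s₂) (ho : σ.zero = r₃ o) :
    Resolves.{w, v, u} σ (Cat.of P₀)
      (ordFun ((r₃.toOrderHom.comp r₂.toOrderHom).comp r₁.toOrderHom)) := by
  intro D hD B
  let R₁ := D.res (prodRes (ordFun r₁.toOrderHom) B)
  let R₂ := D.res (prodRes (ordFun r₂.toOrderHom) B)
  let R₃ := D.res (prodRes (ordFun r₃.toOrderHom) B)
  -- Each extension takes as its `Q'` the conditions imposed so far, so that the conditions
  -- accumulate.
  let Q₁ : D.Diag (Cat.of (Cat.of P₁ × B)) → Prop :=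
    fun X => True ∧ SquareCondition (ordFun s₁) X
  let Q₂ : D.Diag (Cat.of (Cat.of P₂ × B)) → Prop :=
    fun X => Q₁ (R₂.obj X) ∧ ZeroCondition (E := Cat.of P₂) o X
  have hQ₁ : ∀ X Y, (X ≅ Y) → Q₁ X → Q₁ Y := fun X Y e h => ⟨trivial, h.2.of_iso e⟩
  have hQ₂ : ∀ X Y, (X ≅ Y) → Q₂ X → Q₂ Y :=
    fun X Y e h => ⟨hQ₁ _ _ (R₂.mapIso e) h.1, h.2.of_iso e⟩
  have H := ((h₃ D hD B Q₂ hQ₂).comp (h₂ D hD B Q₁ hQ₁)).comp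
    (h₁ D hD B (fun _ => True) fun _ _ _ _ => trivial)
  let e : (R₃ ⋙ R₂) ⋙ R₁ ≅ D.res
      (prodRes (ordFun ((r₃.toOrderHom.comp r₂.toOrderHom).comp r₁.toOrderHom)) B) :=
    Functor.isoWhiskerRight
      (D.resComp (prodRes (ordFun r₂.toOrderHom) B) (prodRes (ordFun r₃.toOrderHom) B)).symm R₁ ≪≫
      (D.resComp (prodRes (ordFun r₁.toOrderHom) B)
        (prodRes (ordFun r₂.toOrderHom) B ≫ prodRes (ordFun r₃.toOrderHom) B)).symm
  refine H.congr e fun X => ?_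
  have k₁ : SquareCondition (ordFun s₁) (R₂.obj (R₃.obj X)) ↔ SquareCondition σ.square₁ X := by
    rw [squareCondition_res_iff, squareCondition_res_iff, hs₁]
    rfl
  have k₂ : ZeroCondition (E := Cat.of P₂) o (R₃.obj X) ↔ ZeroCondition σ.zero X := by
    rw [ho]
    exact zeroCondition_res_iff (E := Cat.of P) _ _ _
  constructor
  · intro h
    exact ⟨k₁.1 h.1.1.2, by rw [hs₂]; exact h.2, k₂.1 h.1.2⟩
  · intro h
    exact ⟨⟨⟨trivial, k₁.2 h.square₁⟩, k₂.2 h.zero⟩, by rw [← hs₂]; exact h.square₂⟩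

end Shape

/-! ### The two posets -/

/-- The vertices of a poset with seven elements. -/
inductive Vertex : Type w
  | a | x | b | c | d | o | f
  deriving DecidableEq

namespace Vertex

instance : Fintype Vertex.{w} := ⟨{a, x, b, c, d, o, f}, fun p => by cases p <;> decide⟩

/-- An embedding of the vertices into the plane, from which they inherit the order generated by
`a < x`, `x < b`, `x < c`, `b < d`, `c < d`, `x < f`, `a < o` and `o < f`. -/
def position : Vertex.{w} → ℕ × ℕ
  | a => (0, 0)
  | x => (1, 2)
  | b => (2, 5)
  | c => (3, 4)
  | d => (4, 6)
  | o => (5, 1)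
  | f => (6, 3)

instance : Preorder Vertex.{w} := Preorder.lift position

instance : DecidableLE Vertex.{w} := fun p q =>
  inferInstanceAs (Decidable (position p ≤ position q))

end Vertex

/-! ### Decidability of the orders -/

section Decidability

instance : DecidableLE (ULift.{w} (Fin 2 × Fin 2)) := fun p q =>
  inferInstanceAs (Decidable (p.down ≤ q.down))

instance : DecidableLE Vertex.{w}ᵒᵈ := fun p q =>
  inferInstanceAs (Decidable (OrderDual.ofDual q ≤ OrderDual.ofDual p))

instance (S : Vertex.{w}ᵒᵈ → Prop) : DecidableLE {p // S p} := fun p q =>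
  inferInstanceAs (Decidable (p.1 ≤ q.1))

instance : DecidableLE (ULift.{w} (Fin 3 → Fin 2)) := fun p q =>
  inferInstanceAs (Decidable (∀ i, p.down i ≤ q.down i))

end Decidability

/-- The square with the given vertices. -/
def squareOf {P : Type w} [Preorder P] (p q r s : P)
    (h : p ≤ q ∧ p ≤ r ∧ q ≤ s ∧ r ≤ s) : ULift.{w} (Fin 2 × Fin 2) →o P where
  toFun j := if j.down.1 = 0 then (if j.down.2 = 0 then p else q) else
    if j.down.2 = 0 then r else s
  monotone' := by
    obtain ⟨h₁, h₂, h₃, h₄⟩ := h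
    rintro ⟨i, j⟩ ⟨i', j'⟩ ⟨hi, hj⟩
    have h₅ := h₁.trans h₃
    fin_cases i <;> fin_cases i' <;> fin_cases j <;> fin_cases j' <;> simp_all

/-- The square with the given vertices in a subset. -/
abbrev squareIn {P : Type w} [Preorder P] (S : P → Prop) (p q r s : P)
    (h : p ≤ q ∧ p ≤ r ∧ q ≤ s ∧ r ≤ s) (hS : S p ∧ S q ∧ S r ∧ S s) :
    ULift.{w} (Fin 2 × Fin 2) →o {p : P // S p} :=
  squareOf ⟨p, hS.1⟩ ⟨q, hS.2.1⟩ ⟨r, hS.2.2.1⟩ ⟨s, hS.2.2.2⟩ h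

/-- The inclusion of a subtype into a larger one. -/
def subtypeIncl {P : Type w} [Preorder P] {p q : P → Prop} (h : ∀ x, p x → q x) :
    {x // p x} ↪o {x // q x} :=
  ⟨⟨fun x => ⟨x.1, h _ x.2⟩, fun _ _ h' => Subtype.ext (congrArg Subtype.val h' :)⟩, Iff.rfl⟩

namespace Vertex

open OrderDual

/-- The bicartesian squares `(x, b, c, d)` and `(a, x, o, f)` and the vanishing at `o`. -/
def sourceShape : Shape (Cat.of Vertex.{w}) where
  square₁ := ordFun (squareOf x b c d (by decide))
  square₂ := ordFun (squareOf a x o f (by decide))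
  zero := o

/-- The bicartesian squares and the vanishing condition on the dual poset. -/
def sinkShape : Shape (Cat.of Vertex.{w}ᵒᵈ) where
  square₁ := ordFun (squareOf (toDual d) (toDual b) (toDual c) (toDual x) (by decide))
  square₂ := ordFun (squareOf (toDual f) (toDual x) (toDual o) (toDual a) (by decide))
  zero := toDual o

/-- The trivalent source as a subset of the vertices. -/
def ofSource : {y : ULift.{w} (Fin 3 → Fin 2) // ∑ i, (y.down i : ℕ) ≤ 1} ↪o
    {p : Vertex.{w} // p ≠ a ∧ p ≠ o} where
  toFun y := if y.1.down 0 = 1 then ⟨b, by decide⟩ else if y.1.down 1 = 1 then ⟨c, by decide⟩ else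
    if y.1.down 2 = 1 then ⟨f, by decide⟩ else ⟨x, by decide⟩
  inj' := by unfold Function.Injective; decide
  map_rel_iff' := by decide

/-- The trivalent sink as a subset of the dual of the vertices. -/
def ofSink : {y : ULift.{w} (Fin 3 → Fin 2) // 2 ≤ ∑ i, (y.down i : ℕ)} ↪o
    {p : Vertex.{w}ᵒᵈ // p ≠ toDual a ∧ p ≠ toDual o} where
  toFun y := if y.1.down 0 = 0 then ⟨toDual b, by decide⟩ else
    if y.1.down 1 = 0 then ⟨toDual c, by decide⟩ else
    if y.1.down 2 = 0 then ⟨toDual f, by decide⟩ else ⟨toDual x, by decide⟩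
  inj' := by unfold Function.Injective; decide
  map_rel_iff' := by decide

/-- The square as a subset of the vertices. -/
def ofSquare : ULift.{w} (Fin 2 × Fin 2) ↪o {p : Vertex.{w} // p ≠ o ∧ p ≠ f} where
  toFun := squareIn _ a b c d (by decide) (by decide)
  inj' := by unfold Function.Injective; decide
  map_rel_iff' := by decide

/-- The square as a subset of the dual of the vertices. -/
def ofSquareDual : ULift.{w} (Fin 2 × Fin 2) ↪o
    {p : Vertex.{w}ᵒᵈ // p ≠ toDual o ∧ p ≠ toDual f} where
  toFun := squareIn _ (toDual d) (toDual b) (toDual c) (toDual a) (by decide) (by decide)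
  inj' := by unfold Function.Injective; decide
  map_rel_iff' := by decide

/-- From `x → b, c, f`: add `d` as the pushout of `b ← x → c`; add `o` by zero from the left, since
without `a` nothing lies below it; add `a` as the pullback of `x → f ← o`, the fibre of `x → f`. -/
theorem exists_resolves_source :
    ∃ r, Shape.Resolves.{w, v, u} sourceShape trivalentSource.{w} r :=
  ⟨_, Shape.resolves_of_isExtension sourceShape ofSource
    (subtypeIncl (q := fun p => p ≠ a) (by decide)) (OrderEmbedding.subtype _)
    (squareIn _ x b c d (by decide) (by decide))
    (squareOf a x o f (by decide)) ⟨o, by decide⟩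
    (fun D hD => isExtension_pushout hD _ _ (by decide) (by decide) (by decide))
    (fun D hD => isExtension_initial hD _ _ (by decide) (by decide))
    (fun D hD => isExtension_pullback hD _ _ (by decide) (by decide) (by decide))
    (congrArg ordFun (OrderHom.ext _ _ (funext (by decide)))) rfl rfl⟩

/-- In the dual order `b, c, f → x`: `d` is the pullback of `b → x ← c`, `o` is extended by zero
from the right, and `a` is the cofibre of `f → x`. -/
theorem exists_resolves_sink :
    ∃ r, Shape.Resolves.{w, v, u} sinkShape trivalentSink.{w} r :=
  ⟨_, Shape.resolves_of_isExtension sinkShape ofSink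
    (subtypeIncl (q := fun p => p ≠ toDual a) (by decide)) (OrderEmbedding.subtype _)
    (squareIn _ (toDual d) (toDual b) (toDual c) (toDual x) (by decide) (by decide))
    (squareOf (toDual f) (toDual x) (toDual o) (toDual a) (by decide)) ⟨toDual o, by decide⟩
    (fun D hD => isExtension_pullback hD _ _ (by decide) (by decide) (by decide))
    (fun D hD => isExtension_terminal hD _ _ (by decide) (by decide))
    (fun D hD => isExtension_pushout hD _ _ (by decide) (by decide) (by decide))
    (congrArg ordFun (OrderHom.ext _ _ (funext (by decide)))) rfl rfl⟩

/-- From the square `a, b, c, d`: add `x` as the pullback of `b → d ← c`; add `o` by zero from the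
right, since without `f` nothing lies above it; add `f` as the cofibre of `a → x`. -/
theorem exists_resolves_square :
    ∃ r, Shape.Resolves.{w, v, u} sourceShape commSquare.{w} r :=
  ⟨_, Shape.resolves_of_isExtension sourceShape ofSquare
    (subtypeIncl (q := fun p => p ≠ f) (by decide)) (OrderEmbedding.subtype _)
    (squareIn _ x b c d (by decide) (by decide))
    (squareOf a x o f (by decide)) ⟨o, by decide⟩
    (fun D hD => isExtension_pullback hD _ _ (by decide) (by decide) (by decide))
    (fun D hD => isExtension_terminal hD _ _ (by decide) (by decide))
    (fun D hD => isExtension_pushout hD _ _ (by decide) (by decide) (by decide))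
    (congrArg ordFun (OrderHom.ext _ _ (funext (by decide)))) rfl rfl⟩

/-- In the dual order the square runs from `d` to `a`: `x` is the pushout of `b ← d → c`, and `f` is
the fibre of `x → a`. -/
theorem exists_resolves_square_dual :
    ∃ r, Shape.Resolves.{w, v, u} sinkShape commSquare.{w} r :=
  ⟨_, Shape.resolves_of_isExtension sinkShape ofSquareDual
    (subtypeIncl (q := fun p => p ≠ toDual f) (by decide)) (OrderEmbedding.subtype _)
    (squareIn _ (toDual d) (toDual b) (toDual c) (toDual x) (by decide) (by decide))
    (squareOf (toDual f) (toDual x) (toDual o) (toDual a) (by decide)) ⟨toDual o, by decide⟩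
    (fun D hD => isExtension_pushout hD _ _ (by decide) (by decide) (by decide))
    (fun D hD => isExtension_initial hD _ _ (by decide) (by decide))
    (fun D hD => isExtension_pullback hD _ _ (by decide) (by decide) (by decide))
    (congrArg ordFun (OrderHom.ext _ _ (funext (by decide)))) rfl rfl⟩

end Vertex

/-! ### Sections of strong transformations -/

section Sections

universe w₁ w₂ v₁ v₂ u₁ u₂

variable {B : Type u₁} [Bicategory.{w₁, v₁} B] {K : Type u₂} [Bicategory.{w₂, v₂} K]
  {S F : Pseudofunctor B K}

/-- A class of 1-morphisms into the values of `S` between which `ρ` is fully faithful. -/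
structure IsFullyFaithfulOn (E : ∀ ⦃z : K⦄ ⦃c : B⦄, (z ⟶ S.obj c) → Prop) (ρ : S ⟶ F) : Prop where
  of_iso {z : K} {c : B} {f g : z ⟶ S.obj c} : (f ≅ g) → E f → E g
  comp_left {z z' : K} {c : B} (h : z' ⟶ z) {f : z ⟶ S.obj c} : E f → E (h ≫ f)
  comp_map {z : K} {c d : B} {f : z ⟶ S.obj c} (u : c ⟶ d) : E f → E (f ≫ S.map u)
  bijective {z : K} {c : B} {f g : z ⟶ S.obj c} : E f → E g →
    Function.Bijective fun α : f ⟶ g => α ▷ ρ.app c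

variable {E : ∀ ⦃z : K⦄ ⦃c : B⦄, (z ⟶ S.obj c) → Prop} {ρ : S ⟶ F}

namespace IsFullyFaithfulOn

variable (hE : IsFullyFaithfulOn E ρ)
include hE

theorem exists_iso {z : K} {c : B} {f g : z ⟶ S.obj c} (hf : E f) (hg : E g)
    (t : f ≫ ρ.app c ≅ g ≫ ρ.app c) : ∃ i : f ≅ g, i.hom ▷ ρ.app c = t.hom := by
  obtain ⟨α, hα⟩ := (hE.bijective hf hg).2 t.hom
  obtain ⟨β, hβ⟩ := (hE.bijective hg hf).2 t.inv
  dsimp only at hα hβ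
  refine ⟨⟨α, β, (hE.bijective hf hf).1 ?_, (hE.bijective hg hg).1 ?_⟩, hα⟩ <;>
  simp [hα, hβ]

/-- Lifts full faithfulness from 2-cells to modifications: the components have unique lifts, and
these are natural because they are so after whiskering with `ρ`. This carries the property from a
fixed `D` to the level of 2-functors in `D`. -/
theorem bijective_modification {Z : Pseudofunctor B K} (f g : Z ⟶ S) (hf : ∀ c, E (f.app c))
    (hg : ∀ c, E (g.app c)) : Function.Bijective fun Γ : f ⟶ g => Γ ▷ ρ := by
  constructor
  · intro Γ Γ' h
    ext c
    refine (hE.bijective (hf c) (hg c)).1 ?_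
    exact congrArg (fun Ξ : f ≫ ρ ⟶ g ≫ ρ => Ξ.as.app c) h
  · intro Ξ
    choose Γ hΓ using fun c => (hE.bijective (hf c) (hg c)).2 (Ξ.as.app c)
    dsimp only at hΓ
    refine ⟨⟨⟨Γ, ?_⟩⟩, ?_⟩
    · intro b c u
      refine (hE.bijective (hE.comp_left _ (hf c)) (hE.comp_map _ (hg b))).1 ?_
      have h : Z.map u ◁ (Γ c ▷ ρ.app c) ≫ (α_ (Z.map u) (g.app c) (ρ.app c)).inv ≫
          (g.naturality u).hom ▷ ρ.app c ≫ (α_ (g.app b) (S.map u) (ρ.app c)).hom ≫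
            g.app b ◁ (ρ.naturality u).hom ≫ (α_ (g.app b) (ρ.app b) (F.map u)).inv =
          ((α_ (Z.map u) (f.app c) (ρ.app c)).inv ≫ (f.naturality u).hom ▷ ρ.app c ≫
            (α_ (f.app b) (S.map u) (ρ.app c)).hom ≫
              f.app b ◁ (ρ.naturality u).hom ≫ (α_ (f.app b) (ρ.app b) (F.map u)).inv) ≫
            (Γ b ▷ ρ.app b) ▷ F.map u := by
        rw [hΓ, hΓ]
        exact Ξ.as.naturality u
      rw [← cancel_epi (α_ (Z.map u) (f.app c) (ρ.app c)).inv,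
        ← cancel_mono ((α_ (g.app b) (S.map u) (ρ.app c)).hom ≫ g.app b ◁ (ρ.naturality u).hom ≫
          (α_ (g.app b) (ρ.app b) (F.map u)).inv)]
      simp only [comp_whiskerRight, whisker_assoc, Category.assoc, Iso.inv_hom_id_assoc]
      rw [h]
      simp only [Category.assoc, associator_naturality_left_assoc]
      rw [← whisker_exchange_assoc, associator_inv_naturality_left]
    · ext c
      exact hΓ c

end IsFullyFaithfulOn

variable (j : ∀ b, F.obj b ⟶ S.obj b) (e : ∀ b, j b ≫ ρ.app b ≅ 𝟙 (F.obj b))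

/-- The comparison isomorphism of a section after composition with `ρ`. -/
def sectionNaturality {b c : B} (u : b ⟶ c) :
    (F.map u ≫ j c) ≫ ρ.app c ≅ (j b ≫ S.map u) ≫ ρ.app c :=
  α_ _ _ _ ≪≫ whiskerLeftIso (F.map u) (e c) ≪≫ ρ_ _ ≪≫ (λ_ _).symm ≪≫
    whiskerRightIso (e b).symm (F.map u) ≪≫ α_ _ _ _ ≪≫
      whiskerLeftIso (j b) (ρ.naturality u).symm ≪≫ (α_ _ _ _).symm

/-- The interchange law moves `x` across the bridge made of `e` and its inverse. The three coherence
lemmas below all rest on this. -/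
theorem section_slide {b c : B} {p q : F.obj b ⟶ F.obj c} (x : p ⟶ q) {z : F.obj b ⟶ F.obj c}
    (y : (j b ≫ ρ.app b) ≫ q ⟶ z) :
    p ◁ (e c).hom ≫ (ρ_ p).hom ≫ (λ_ p).inv ≫ (e b).inv ▷ p ≫ (j b ≫ ρ.app b) ◁ x ≫ y =
      x ▷ (j c ≫ ρ.app c) ≫ q ◁ (e c).hom ≫ (ρ_ q).hom ≫ (λ_ q).inv ≫ (e b).inv ▷ q ≫ y := by
  rw [← whisker_exchange_assoc, ← leftUnitor_inv_naturality_assoc, ← rightUnitor_naturality_assoc,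
    whisker_exchange_assoc]

theorem sectionNaturality_naturality {b c : B} {u u' : b ⟶ c} (η : u ⟶ u') :
    F.map₂ η ▷ j c ▷ ρ.app c ≫ (sectionNaturality j e u').hom =
      (sectionNaturality j e u).hom ≫ (j b ◁ S.map₂ η) ▷ ρ.app c := by
  have h : (ρ.naturality u).inv ≫ S.map₂ η ▷ ρ.app c =
      ρ.app b ◁ F.map₂ η ≫ (ρ.naturality u').inv := by
    rw [Iso.inv_comp_eq, ← Category.assoc, ← ρ.naturality_naturality, Category.assoc,
      Iso.hom_inv_id, Category.comp_id]
  have h' := section_slide j e (F.map₂ η)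
    ((α_ _ _ _).hom ≫ j b ◁ (ρ.naturality u').inv ≫ (α_ (j b) (S.map u') (ρ.app c)).inv)
  simp only [sectionNaturality, Iso.trans_hom, whiskerLeftIso_hom, whiskerRightIso_hom,
    Iso.symm_hom, Category.assoc, whisker_assoc, Iso.inv_hom_id_assoc]
  rw [← whiskerLeft_comp_assoc, h, associator_naturality_left_assoc, ← h']
  simp

theorem sectionNaturality_id (b : B) :
    (sectionNaturality j e (𝟙 b)).hom ≫ (j b ◁ (S.mapId b).hom) ▷ ρ.app b =
      ((F.mapId b).hom ▷ j b ≫ (λ_ (j b)).hom ≫ (ρ_ (j b)).inv) ▷ ρ.app b := by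
  have h' := section_slide j e (F.mapId b).hom
    ((α_ _ _ _).hom ≫ j b ◁ (ρ_ (ρ.app b)).hom ≫ j b ◁ (λ_ (ρ.app b)).inv ≫
      (α_ (j b) _ (ρ.app b)).inv)
  simp only [sectionNaturality, Iso.trans_hom, whiskerLeftIso_hom, whiskerRightIso_hom,
    Iso.symm_hom, Category.assoc, whisker_assoc, Iso.inv_hom_id_assoc,
    ρ.naturality_id_inv, whiskerLeft_comp, comp_whiskerRight]
  simp
  simp at h'
  exact (Iso.eq_inv_comp _).1 h'

theorem sectionNaturality_comp {a b c : B} (u : a ⟶ b) (v : b ⟶ c)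
    (n : F.map u ≫ j b ⟶ j a ≫ S.map u) (m : F.map v ≫ j c ⟶ j b ≫ S.map v)
    (hn : n ▷ ρ.app b = (sectionNaturality j e u).hom)
    (hm : m ▷ ρ.app c = (sectionNaturality j e v).hom) :
    (sectionNaturality j e (u ≫ v)).hom ≫ (j a ◁ (S.mapComp u v).hom) ▷ ρ.app c =
      ((F.mapComp u v).hom ▷ j c ≫ (α_ _ _ _).hom ≫ F.map u ◁ m ≫ (α_ _ _ _).inv ≫
        n ▷ S.map v ≫ (α_ _ _ _).hom) ▷ ρ.app c := by
  have h : n ▷ S.map v ▷ ρ.app c = (α_ _ _ _).hom ≫ (F.map u ≫ j b) ◁ (ρ.naturality v).hom ≫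
      (α_ _ _ _).inv ≫ (sectionNaturality j e u).hom ▷ F.map v ≫ (α_ _ _ _).hom ≫
      (j a ≫ S.map u) ◁ (ρ.naturality v).inv ≫ (α_ _ _ _).inv := by
    rw [← hn, associator_naturality_left_assoc, Iso.inv_hom_id_assoc, whisker_exchange_assoc]
    simp
  simp only [comp_whiskerRight, h, whisker_assoc, hm]
  have h' := section_slide j e (F.mapComp u v).hom
    ((α_ _ _ _).hom ≫ j a ◁ (α_ (ρ.app a) (F.map u) (F.map v)).inv ≫
      j a ◁ (ρ.naturality u).inv ▷ F.map v ≫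
      j a ◁ (α_ (S.map u) (ρ.app b) (F.map v)).hom ≫
      j a ◁ S.map u ◁ (ρ.naturality v).inv ≫
      j a ◁ (α_ (S.map u) (S.map v) (ρ.app c)).inv ≫
      (α_ (j a) (S.map u ≫ S.map v) (ρ.app c)).inv)
  simp [sectionNaturality, ρ.naturality_comp_inv]
  simp at h'
  exact (Iso.eq_inv_comp _).1 h'

-- A naturality 2-cell of the section is the lift of the canonical one after `ρ`. Lifts being
-- unique, each coherence axiom follows from its image under `ρ`, given by the `sectionNaturality`
-- lemmas.
include e in
theorem IsFullyFaithfulOn.exists_section (hE : IsFullyFaithfulOn E ρ) (hj : ∀ b, E (j b)) :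
    ∃ θ : F ⟶ S, (∀ b, E (θ.app b)) ∧ Nonempty (θ ≫ ρ ≅ 𝟙 F) := by
  have hl {b c : B} (u : b ⟶ c) : E (F.map u ≫ j c) := hE.comp_left _ (hj c)
  have hr {b c : B} (u : b ⟶ c) : E (j b ≫ S.map u) := hE.comp_map _ (hj b)
  -- Both sides lie in the class: `hl` uses closure under precomposition, `hr` closure under the
  -- transition maps of `S`.
  choose n hn using fun {b c : B} (u : b ⟶ c) =>
    hE.exists_iso (hl u) (hr u) (sectionNaturality j e u)
  let θ : F ⟶ S :=
    { app := j
      naturality := fun u => n u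
      naturality_naturality := fun {b c u u'} η => (hE.bijective (hl u) (hr u')).1 <| by
        simp only [comp_whiskerRight, hn]
        exact sectionNaturality_naturality j e η
      naturality_id := fun b => (hE.bijective (hl _)
          (hE.of_iso (whiskerLeftIso (j b) (S.mapId b)) (hr (𝟙 b)))).1 <| by
        simp only [comp_whiskerRight, hn]
        rw [sectionNaturality_id]
        simp only [comp_whiskerRight]
      naturality_comp := fun {a b c} u v => (hE.bijective (hl _)
          (hE.of_iso (whiskerLeftIso (j a) (S.mapComp u v)) (hr (u ≫ v)))).1 <| by
        have := sectionNaturality_comp j e u v _ _ (hn u) (hn v)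
        rw [← hn] at this
        simpa only [comp_whiskerRight] using this }
  refine ⟨θ, hj, ⟨Pseudofunctor.StrongTrans.isoMk e ?_⟩⟩
  intro b c u
  have h : ((α_ (F.map u) (j c) (ρ.app c)).inv ≫ (n u).hom ▷ ρ.app c ≫
      (α_ (j b) (S.map u) (ρ.app c)).hom ≫ j b ◁ (ρ.naturality u).hom ≫
        (α_ (j b) (ρ.app b) (F.map u)).inv) ≫ (e b).hom ▷ F.map u =
      F.map u ◁ (e c).hom ≫ (ρ_ _).hom ≫ (λ_ _).inv := by
    rw [hn]
    simp [sectionNaturality, ← whiskerLeft_comp_assoc, ← comp_whiskerRight]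
  rw [Pseudofunctor.StrongTrans.categoryStruct_comp_naturality_hom]
  exact h.symm

end Sections

/-! ### Restriction as a transformation of 2-functors -/

section Interchange

universe w₁ w₂ w₃ v₁ v₂ v₃ u₁ u₂ u₃

variable {B : Type u₁} [Bicategory.{w₁, v₁} B] {C : Type u₂} [Bicategory.{w₂, v₂} C]
  {K : Type u₃} [Bicategory.{w₃, v₃} K] {P P' : Pseudofunctor B C} (t : P ⟶ P')

/-- The image under a pseudofunctor of a 2-cell between two composites. -/
def map₂Square (H : Pseudofunctor C K) {a b b' c : C} {p : a ⟶ b} {q : b ⟶ c} {q' : a ⟶ b'}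
    {p' : b' ⟶ c} (n : p ≫ q ≅ q' ≫ p') : H.map p ≫ H.map q ≅ H.map q' ≫ H.map p' :=
  (H.mapComp _ _).symm ≪≫ H.map₂Iso n ≪≫ H.mapComp _ _

@[simp]
theorem map₂Square_hom (H : Pseudofunctor C K) {a b b' c : C} {p : a ⟶ b} {q : b ⟶ c}
    {q' : a ⟶ b'} {p' : b' ⟶ c} (n : p ≫ q ≅ q' ≫ p') : (map₂Square H n).hom =
      (H.mapComp p q).inv ≫ H.map₂ n.hom ≫ (H.mapComp q' p').hom :=
  rfl

theorem map₂Square_naturality (H : Pseudofunctor C K) {a b b' c : C} {p₁ p₂ : a ⟶ b} {q : b ⟶ c}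
    {q' : a ⟶ b'} {p₁' p₂' : b' ⟶ c} {n₁ : p₁ ≫ q ≅ q' ≫ p₁'} {n₂ : p₂ ≫ q ≅ q' ≫ p₂'}
    {x : p₁ ⟶ p₂} {y : p₁' ⟶ p₂'} (h : x ▷ q ≫ n₂.hom = n₁.hom ≫ q' ◁ y) :
    H.map₂ x ▷ H.map q ≫ (map₂Square H n₂).hom = (map₂Square H n₁).hom ≫ H.map q' ◁ H.map₂ y := by
  have := congrArg H.map₂ h
  simp only [H.map₂_comp, H.map₂_whisker_right, H.map₂_whisker_left, Category.assoc] at this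
  simp only [map₂Square_hom, Category.assoc]
  rw [← cancel_epi (H.mapComp p₁ q).hom, reassoc_of% this]
  simp

theorem map₂Square_id (H : Pseudofunctor C K) {a b : C} {p : a ⟶ a} {q : a ⟶ b} {p' : b ⟶ b}
    {n : p ≫ q ≅ q ≫ p'} {x : p ⟶ 𝟙 a} {y : p' ⟶ 𝟙 b}
    (h : n.hom ≫ q ◁ y = x ▷ q ≫ (λ_ q).hom ≫ (ρ_ q).inv) :
    (map₂Square H n).hom ≫ H.map q ◁ (H.map₂ y ≫ (H.mapId b).hom) =
      (H.map₂ x ≫ (H.mapId a).hom) ▷ H.map q ≫ (λ_ (H.map q)).hom ≫ (ρ_ (H.map q)).inv := by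
  have := congrArg (fun z => H.map₂ z ≫ (H.mapComp q (𝟙 b)).hom ≫ H.map q ◁ (H.mapId b).hom) h
  simp only [H.map₂_comp, H.map₂_whisker_right, H.map₂_whisker_left, H.map₂_left_unitor,
    Category.assoc, Iso.inv_hom_id_assoc] at this
  rw [← cancel_epi (H.mapComp p q).hom]
  simp only [map₂Square_hom, Category.assoc, whiskerLeft_comp, comp_whiskerRight,
    Iso.hom_inv_id_assoc, this]
  have h' : H.map₂ (ρ_ q).inv ≫ (H.mapComp q (𝟙 b)).hom ≫ H.map q ◁ (H.mapId b).hom =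
      (ρ_ (H.map q)).inv := by
    rw [← cancel_epi (H.map₂ (ρ_ q).hom), ← H.map₂_comp_assoc]
    simp
  rw [h']

theorem map₂Square_comp (H : Pseudofunctor C K) {a b c a' b' c' : C} {p : a ⟶ b} {q : b ⟶ c}
    {p' : a' ⟶ b'} {q' : b' ⟶ c'} {s : a ⟶ c} {s' : a' ⟶ c'} {ta : a ⟶ a'} {tb : b ⟶ b'}
    {tc : c ⟶ c'} {n : s ≫ tc ≅ ta ≫ s'} {m : p ≫ tb ≅ ta ≫ p'} {l : q ≫ tc ≅ tb ≫ q'}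
    {x : s ⟶ p ≫ q} {y : s' ⟶ p' ≫ q'}
    (h : n.hom ≫ ta ◁ y = x ▷ tc ≫ (α_ _ _ _).hom ≫ p ◁ l.hom ≫ (α_ _ _ _).inv ≫
      m.hom ▷ q' ≫ (α_ _ _ _).hom) :
    (map₂Square H n).hom ≫ H.map ta ◁ (H.map₂ y ≫ (H.mapComp p' q').hom) =
      (H.map₂ x ≫ (H.mapComp p q).hom) ▷ H.map tc ≫ (α_ _ _ _).hom ≫
        H.map p ◁ (map₂Square H l).hom ≫ (α_ _ _ _).inv ≫ (map₂Square H m).hom ▷ H.map q' ≫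
          (α_ _ _ _).hom := by
  have := congrArg (fun z => H.map₂ z ≫ (H.mapComp ta (p' ≫ q')).hom ≫
    H.map ta ◁ (H.mapComp p' q').hom) h
  have h' : (H.mapComp p (tb ≫ q')).inv ≫ H.map₂ (α_ p tb q').inv ≫ (H.mapComp (p ≫ tb) q').hom =
      H.map p ◁ (H.mapComp tb q').hom ≫ (α_ _ _ _).inv ≫ (H.mapComp p tb).inv ▷ H.map q' := by
    rw [← cancel_epi (H.mapComp p (tb ≫ q')).hom, ← cancel_epi (H.map₂ (α_ p tb q').hom),
      Iso.hom_inv_id_assoc, ← H.map₂_comp_assoc]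
    simp
  simp at this
  rw [reassoc_of% h'] at this
  rw [← cancel_epi (H.mapComp s tc).hom]
  simpa using this

/-- Postcomposition of a strong transformation with a pseudofunctor. -/
def postcompTrans (H : Pseudofunctor C K) : P.comp H ⟶ P'.comp H where
  app b := H.map (t.app b)
  naturality u := map₂Square H (t.naturality u)
  naturality_naturality x := map₂Square_naturality H (t.naturality_naturality x)
  naturality_id a := map₂Square_id H (t.naturality_id a)
  naturality_comp u v := map₂Square_comp H (t.naturality_comp u v)

/-- This is the naturality of `F` at the 2-cell `n`, with its naturality at both composites expanded
and the invertible cells moved across. -/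
theorem interchange_aux {H H' : Pseudofunctor C K} (F : H ⟶ H') {a b a' b' : C} {p : a ⟶ b}
    {p' : a' ⟶ b'} {ta : a ⟶ a'} {tb : b ⟶ b'} (n : p ≫ tb ≅ ta ≫ p') :
    H.map p ◁ (F.naturality tb).inv ≫ (α_ _ _ _).inv ≫ (map₂Square H n).hom ▷ F.app b' ≫
        (α_ _ _ _).hom ≫ H.map ta ◁ (F.naturality p').hom ≫ (α_ _ _ _).inv =
      ((α_ _ _ _).inv ≫ (F.naturality p).hom ▷ H'.map tb ≫ (α_ _ _ _).hom ≫
        F.app a ◁ (map₂Square H' n).hom ≫ (α_ _ _ _).inv) ≫ (F.naturality ta).inv ▷ H'.map p' := by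
  have h := F.naturality_naturality n.hom
  rw [F.naturality_comp_hom, F.naturality_comp_hom] at h
  rw [← cancel_epi ((H.mapComp p tb).hom ▷ F.app b' ≫ (α_ (H.map p) (H.map tb) (F.app b')).hom ≫
      H.map p ◁ (F.naturality tb).hom),
    ← cancel_mono ((F.naturality ta).hom ▷ H'.map p' ≫
      (α_ (F.app a) (H'.map ta) (H'.map p')).hom ≫ F.app a ◁ (H'.mapComp ta p').inv)]
  simpa using h

theorem whiskerRight_naturality_inv {H H' : Pseudofunctor C K} {F G : H ⟶ H'} (x : F ⟶ G)
    {a b : C} (t : a ⟶ b) : x.as.app a ▷ H'.map t ≫ (G.naturality t).inv =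
      (F.naturality t).inv ≫ H.map t ◁ x.as.app b := by
  rw [Iso.eq_inv_comp, ← Category.assoc, ← x.as.naturality t, Category.assoc, Iso.hom_inv_id,
    Category.comp_id]

theorem id_naturality_inv_aux (H : Pseudofunctor C K) {a b : C} (t : a ⟶ b) :
    (Pseudofunctor.StrongTrans.naturality (𝟙 H) t).inv ≫ H.map t ◁ 𝟙 (𝟙 (H.obj b)) =
      𝟙 (𝟙 (H.obj a)) ▷ H.map t ≫ (λ_ _).hom ≫ (ρ_ _).inv := by
  refine (congrArg (_ ≫ ·) (whiskerLeft_id _ _)).trans ((Category.comp_id _).trans ?_)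
  rw [id_whiskerRight, Category.id_comp]
  exact Pseudofunctor.StrongTrans.categoryStruct_id_naturality_inv _ _

theorem comp_naturality_inv_aux {H H' H'' : Pseudofunctor C K} (F : H ⟶ H') (G : H' ⟶ H'')
    {a b : C} (t : a ⟶ b) :
    (Pseudofunctor.StrongTrans.naturality (F ≫ G) t).inv ≫ H.map t ◁ 𝟙 (F.app b ≫ G.app b) =
      𝟙 (F.app a ≫ G.app a) ▷ H''.map t ≫ (α_ _ _ _).hom ≫ F.app a ◁ (G.naturality t).inv ≫
        (α_ _ _ _).inv ≫ (F.naturality t).inv ▷ G.app b ≫ (α_ _ _ _).hom := by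
  refine (congrArg (_ ≫ ·) (whiskerLeft_id _ _)).trans ((Category.comp_id _).trans ?_)
  rw [id_whiskerRight, Category.id_comp]
  have h : ((((α_ (F.app a) (G.app a) (H''.map t)).hom ≫ F.app a ◁ (G.naturality t).inv) ≫
      (α_ _ _ _).inv) ≫ (F.naturality t).inv ▷ G.app b) ≫ (α_ _ _ _).hom =
      (α_ _ _ _).hom ≫ F.app a ◁ (G.naturality t).inv ≫
        (α_ _ _ _).inv ≫ (F.naturality t).inv ▷ G.app b ≫ (α_ _ _ _).hom := by
    simp only [Category.assoc]
  exact (Pseudofunctor.StrongTrans.categoryStruct_comp_naturality_inv F G t).trans h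

/-- The interchange of precomposition and postcomposition. -/
def interchange {H H' : Pseudofunctor C K} (F : H ⟶ H') :
    (precomp (K := K) P).map F ≫ postcompTrans t H' ≅ postcompTrans t H ≫ (precomp P').map F :=
  Pseudofunctor.StrongTrans.isoMk (fun b => (F.naturality (t.app b)).symm)
    fun u => interchange_aux F (t.naturality u)

end Interchange

section Restriction

variable {A E : Cat.{w, w}} (r : A ⟶ E)

/-- Restriction along `r`, as a transformation between the 2-functors `B ↦ E × B` and
`B ↦ A × B`. -/
def prodLeftTrans : (prodLeft E).toPseudofunctor ⟶ (prodLeft A).toPseudofunctor where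
  app B := (prodRes r B.unop).op
  naturality f := Iso.refl _
  naturality_naturality x := by
    apply catOp_hom₂_ext
    intro X
    refine Prod.ext ?_ ?_
    · exact (Category.comp_id _).trans
        (Eq.trans (r.toFunctor.map_id _).symm (Category.id_comp _).symm)
    · exact (Category.comp_id _).trans (Category.id_comp _).symm
  naturality_id B := by
    apply catOp_hom₂_ext
    intro X
    refine Prod.ext ?_ ?_
    · exact ((Category.id_comp _).trans (r.toFunctor.map_id _)).trans (id₃ _).symm
    · exact (Category.id_comp _).trans (id₃ _).symm
  naturality_comp f g := by
    apply catOp_hom₂_ext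
    intro X
    refine Prod.ext ?_ ?_
    · refine ((Category.id_comp _).trans (r.toFunctor.map_id _)).trans ?_
      refine Eq.trans ?_ (Category.id_comp _).symm
      exact (id₅ _).symm
    · refine (Category.id_comp _).trans ?_
      refine Eq.trans ?_ (Category.id_comp _).symm
      refine (id₅ _).symm.trans ?_
      congr 2
      exact (f.unop.toFunctor.map_id _).symm

/-- Restriction along `r`, as a morphism of prederivators. -/
def resHom (D : PDer.{w, v, u}) : shift E D ⟶ shift A D :=
  InducedBicategory.mkHom (postcompTrans (prodLeftTrans r) D.toPseudofunctor)

/-- Restriction along `r`, as a transformation of 2-functors. -/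
def resTrans : shiftFunctor.{w, v, u} E ⟶ shiftFunctor A where
  app D := resHom r D.toPDer
  naturality F := InducedBicategory.isoMk (interchange (prodLeftTrans r) (StDer.Hom.hom F).hom)
  naturality_naturality x :=
    InducedBicategory.hom₂_ext <| Pseudofunctor.StrongTrans.homCategory.ext fun B =>
      whiskerRight_naturality_inv (StDer.Hom₂.hom x).hom (prodRes r B.unop).op
  naturality_id D :=
    InducedBicategory.hom₂_ext <| Pseudofunctor.StrongTrans.homCategory.ext fun B =>
      id_naturality_inv_aux D.toPDer.toPseudofunctor (prodRes r B.unop).op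
  naturality_comp F G :=
    InducedBicategory.hom₂_ext <| Pseudofunctor.StrongTrans.homCategory.ext fun B =>
      comp_naturality_inv_aux (StDer.Hom.hom F).hom (StDer.Hom.hom G).hom (prodRes r B.unop).op

end Restriction

/-! ### Strong stable equivalences -/

/-- The inclusion of the full subcategory on `Q` followed by `G` is an equivalence; the section is
its inverse followed by the inclusion. -/
theorem RestrictsToEquiv.exists_section {C C' : Cat.{v, u}} {G : C ⥤ C'} {Q : C → Prop}
    (h : RestrictsToEquiv G Q fun _ => True) :
    ∃ J : C' ⥤ C, (∀ Y, Q (J.obj Y)) ∧ Nonempty (J ⋙ G ≅ 𝟭 C') := by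
  let ι := ObjectProperty.ι (C := C) Q
  have : (ι ⋙ G).Faithful :=
    ⟨fun {X Y} f g hfg => ι.map_injective ((h.bijective X.1 Y.1 X.2 Y.2).1 hfg)⟩
  have : (ι ⋙ G).Full :=
    ⟨fun {X Y} f => by
      obtain ⟨g, hg⟩ := (h.bijective X.1 Y.1 X.2 Y.2).2 f
      exact ⟨ι.preimage g, (congrArg G.map (ι.map_preimage g)).trans hg⟩⟩
  have : (ι ⋙ G).EssSurj :=
    ⟨fun Y => by
      obtain ⟨X, hX, e⟩ := h.surjective Y trivial
      exact ⟨⟨X, hX⟩, e⟩⟩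
  have : (ι ⋙ G).IsEquivalence := {}
  exact ⟨(ι ⋙ G).inv ⋙ ι, fun Y => ((ι ⋙ G).inv.obj Y).2,
    ⟨(ι ⋙ G).asEquivalence.counitIso⟩⟩

section Equivalence

variable {K : Type*} [Bicategory K] {S F F' : K}

/-- The class `E` plays the role of a full subobject of `S` equivalent to both `F` and `F'`: the
inverse of `j ≫ ρ'` is `j' ≫ ρ`. -/
theorem exists_equivalence_of_sections (E : ∀ ⦃z : K⦄, (z ⟶ S) → Prop)
    (hE : ∀ {z z' : K} (h : z' ⟶ z) {f : z ⟶ S}, E f → E (h ≫ f))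
    (ρ : S ⟶ F) (ρ' : S ⟶ F')
    (hρ : ∀ {z : K} {f g : z ⟶ S}, E f → E g → (f ≫ ρ ≅ g ≫ ρ) → Nonempty (f ≅ g))
    (hρ' : ∀ {z : K} {f g : z ⟶ S}, E f → E g → (f ≫ ρ' ≅ g ≫ ρ') → Nonempty (f ≅ g))
    (j : F ⟶ S) (j' : F' ⟶ S) (hj : E j) (hj' : E j') (e : j ≫ ρ ≅ 𝟙 F) (e' : j' ≫ ρ' ≅ 𝟙 F') :
    ∃ q : Bicategory.Equivalence F F', q.hom = j ≫ ρ' := by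
  -- After `ρ'` both sides become `j ≫ ρ'` because `j'` is a section; as both lie in `E`, the
  -- isomorphism lifts.
  obtain ⟨i⟩ : Nonempty (((j ≫ ρ') ≫ j') ≅ j) := hρ' (hE _ hj') hj
    (α_ _ _ _ ≪≫ whiskerLeftIso _ e' ≪≫ ρ_ _)
  obtain ⟨i'⟩ : Nonempty (((j' ≫ ρ) ≫ j) ≅ j') := hρ (hE _ hj) hj'
    (α_ _ _ _ ≪≫ whiskerLeftIso _ e ≪≫ ρ_ _)
  exact ⟨Bicategory.Equivalence.mkOfAdjointifyCounit (f := j ≫ ρ') (g := j' ≫ ρ)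
    (e.symm ≪≫ whiskerRightIso i.symm ρ ≪≫ α_ _ _ _)
    ((α_ _ _ _).symm ≪≫ whiskerRightIso i' ρ' ≪≫ e'), rfl⟩

end Equivalence

/-! ### Resolutions yield strong stable equivalences -/

namespace Shape

variable {E : Cat.{w, w}} (σ : Shape E)

section Holds

variable {σ} {D : Prederivator.{w, v, u}} {B : Cat.{w, w}} {X Y : D.Diag (Cat.of (E × B))}

theorem Holds.of_iso (h : σ.Holds D B X) (e : X ≅ Y) : σ.Holds D B Y :=
  ⟨h.square₁.of_iso e, h.square₂.of_iso e, h.zero.of_iso e⟩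

theorem Holds.map (h : σ.Holds D B X) {B' : Cat.{w, w}} (f : B' ⟶ B) :
    σ.Holds D B' ((D.res (prodMap E f)).obj X) :=
  ⟨squareCondition_map _ f X h.square₁, squareCondition_map _ f X h.square₂,
    zeroCondition_map _ f X h.zero⟩

end Holds

/-- Here exactness is used: the morphism commutes with restriction up to isomorphism, so the
conditions pass from `D` to `D'`. -/
theorem Holds.map_exact {σ : Shape E} {D D' : PDer.{w, v, u}} {F : D ⟶ D'}
    (hF : IsExact F) {B : Cat.{w, w}}
    {X : Prederivator.Diag D (Cat.of (E × B))} (h : σ.Holds D B X) :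
    σ.Holds D' B ((component F (Cat.of (E × B))).obj X) := by
  have key {J : Cat.{w, w}} (t : J ⟶ Cat.of (E × B)) :
      (component F J).obj ((Prederivator.res D t).obj X) ≅
        (Prederivator.res D' t).obj ((component F (Cat.of (E × B))).obj X) :=
    (Cat.Hom.toNatIso (F.hom.naturality t.op)).app X
  exact ⟨fun b => IsBicartesian.of_iso (key _) (hF.map_bicartesian _ (h.square₁ b)),
    fun b => IsBicartesian.of_iso (key _) (hF.map_bicartesian _ (h.square₂ b)),
    fun b => (hF.map_zero _ (h.zero b)).of_iso (key _).symm⟩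

/-- The functors into `D(E × B)` whose values satisfy the conditions of `σ`. -/
def Lands (D : PDer.{w, v, u}) ⦃z : Cat.{v, u}⦄ ⦃B : (Cat.{w, w})ᵒᵖ⦄
    (f : z ⟶ (shift E D).toPseudofunctor.obj B) : Prop :=
  ∀ X, σ.Holds D B.unop (f.toFunctor.obj X)

variable {σ} {A : Cat.{w, w}} {r : A ⟶ E}

theorem Resolves.isFullyFaithfulOn (h : Resolves.{w, v, u} σ A r) {D : PDer.{w, v, u}}
    (hD : IsStableDerivator D) : IsFullyFaithfulOn (σ.Lands D) (resHom r D).hom where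
  of_iso {z B f g} e hf X := Holds.of_iso (hf X) ((Cat.Hom.toNatIso e).app X)
  comp_left k f hf X := hf (k.toFunctor.obj X)
  comp_map u hf X := Holds.map (hf X) u.unop
  bijective {z B f g} hf hg := by
    have hb (X Y : z) := (h D hD B.unop).bijective _ _ (hf X) (hg Y)
    constructor
    · intro x y hxy
      refine cat_hom₂_ext fun X => ?_
      have hX : (D.res (prodRes r B.unop)).map (x.toNatTrans.app X) =
          (D.res (prodRes r B.unop)).map (y.toNatTrans.app X) :=
        congrArg (fun t => t.toNatTrans.app X) hxy
      exact (hb X X).1 hX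
    · intro x
      choose y hy using fun X => (hb X X).2 (x.toNatTrans.app X)
      have hn (X Y : z) (t : X ⟶ Y) :
          f.toFunctor.map t ≫ y Y = y X ≫ g.toFunctor.map t := by
        apply (hb X Y).1
        refine (Functor.map_comp _ _ _).trans (Eq.trans ?_ (Functor.map_comp _ _ _).symm)
        rw [hy, hy]
        exact x.toNatTrans.naturality t
      refine ⟨Cat.Hom₂.ofNatTrans ⟨y, hn⟩, ?_⟩
      exact cat_hom₂_ext (g := g ≫ (resHom r D).hom.app B) hy

/-- The sections chosen for each parameter category `B` are made pseudo-natural in `B`; the result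
serves as objectwise input for naturality in `D`. -/
theorem Resolves.exists_section (h : Resolves.{w, v, u} σ A r) {D : PDer.{w, v, u}}
    (hD : IsStableDerivator D) : ∃ θ : shift A D ⟶ shift E D,
      (∀ B, σ.Lands D (θ.hom.app B)) ∧ Nonempty (θ ≫ resHom r D ≅ 𝟙 (shift A D)) := by
  choose J hJ e using fun B : (Cat.{w, w})ᵒᵖ => (h D hD B.unop).exists_section
  let j (B : (Cat.{w, w})ᵒᵖ) :
      (shift A D).toPseudofunctor.obj B ⟶ (shift E D).toPseudofunctor.obj B :=
    Functor.toCatHom (C := Prederivator.Diag D (Cat.of (A × B.unop)))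
      (D := Prederivator.Diag D (Cat.of (E × B.unop))) (J B)
  let k (B : (Cat.{w, w})ᵒᵖ) : j B ≫ (resHom r D).hom.app B ≅ 𝟙 _ := Cat.Hom.isoMk (e B).some
  obtain ⟨θ, hθ, ⟨i⟩⟩ := (h.isFullyFaithfulOn hD).exists_section j k hJ
  exact ⟨InducedBicategory.mkHom θ, hθ, ⟨InducedBicategory.isoMk i⟩⟩

theorem Resolves.isFullyFaithfulOn_shiftFunctor (h : Resolves.{w, v, u} σ A r) :
    IsFullyFaithfulOn (S := shiftFunctor.{w, v, u} E)
      (fun _ D f => ∀ B, σ.Lands D.toPDer (f.hom.app B)) (resTrans r) where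
  of_iso e hf B X := Holds.of_iso (hf B X)
    ⟨(e.hom.hom.as.app B).toNatTrans.app X, (e.inv.hom.as.app B).toNatTrans.app X,
      congrArg (fun t => (t.hom.as.app B).toNatTrans.app X) e.hom_inv_id,
      congrArg (fun t => (t.hom.as.app B).toNatTrans.app X) e.inv_hom_id⟩
  comp_left k f hf B X := hf B _
  comp_map u hf B X := Holds.map_exact (StDer.Hom.exact u) (hf B X)
  bijective {Z D f g} hf hg := by
    have := (h.isFullyFaithfulOn D.stable).bijective_modification f.hom g.hom hf hg
    constructor
    · intro x y hxy
      exact InducedBicategory.hom₂_ext (this.1 (congrArg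
        (fun t : f ≫ resHom r D.toPDer ⟶ g ≫ resHom r D.toPDer => t.hom) hxy))
    · intro x
      obtain ⟨y, hy⟩ := this.2 x.hom
      exact ⟨InducedBicategory.Hom₂.mk y, InducedBicategory.hom₂_ext hy⟩

/-- Pseudo-naturality in `D` is only needed for the section along `r`, since restriction along `r'`
is already a transformation. Invertibility is checked for one `D` at a time, with an arbitrary
section along `r'`. -/
theorem Resolves.stronglyStablyEquivalent (h : Resolves.{w, v, u} σ A r) {A' : Cat.{w, w}}
    {r' : A' ⟶ E} (h' : Resolves.{w, v, u} σ A' r') :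
    StronglyStablyEquivalent.{w, v, u} A A' := by
  choose j hj e using fun D : StDer.{w, v, u} => h.exists_section D.stable
  choose j' hj' e' using fun D : StDer.{w, v, u} => h'.exists_section D.stable
  obtain ⟨θ, hθ, ⟨i⟩⟩ := h.isFullyFaithfulOn_shiftFunctor.exists_section j (fun D => (e D).some) hj
  refine ⟨⟨θ ≫ resTrans r', fun D => ?_⟩⟩
  refine exists_equivalence_of_sections (S := shift E D.toPDer)
    (fun (z : PDer.{w, v, u}) (f : z ⟶ shift E D.toPDer) => ∀ B, σ.Lands D.toPDer (f.hom.app B))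
    (fun k _ hf => h.isFullyFaithfulOn_shiftFunctor.comp_left (c := D) k hf)
    (resHom r D.toPDer) (resHom r' D.toPDer)
    (fun hf hg t => ⟨(h.isFullyFaithfulOn_shiftFunctor.exists_iso (c := D) hf hg t).choose⟩)
    (fun hf hg t => ⟨(h'.isFullyFaithfulOn_shiftFunctor.exists_iso (c := D) hf hg t).choose⟩)
    (θ.app D) (j' D) (hθ D) (hj' D) ?_ (e' D).some
  exact ⟨i.hom.as.app D, i.inv.as.app D, congrArg (fun t => t.as.app D) i.hom_inv_id,
    congrArg (fun t => t.as.app D) i.inv_hom_id⟩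

end Shape

theorem StronglyStablyEquivalent.trans {A A' A'' : Cat.{w, w}}
    (h : StronglyStablyEquivalent.{w, v, u} A A') (h' : StronglyStablyEquivalent.{w, v, u} A' A'') :
    StronglyStablyEquivalent.{w, v, u} A A'' := by
  obtain ⟨⟨Φ, hΦ⟩⟩ := h
  obtain ⟨⟨Ψ, hΨ⟩⟩ := h'
  refine ⟨⟨Φ.vcomp Ψ, fun D => ?_⟩⟩
  obtain ⟨p, hp⟩ := hΦ D
  obtain ⟨q, hq⟩ := hΨ D
  refine ⟨Bicategory.Equivalence.mkOfAdjointifyCounit (f := p.hom ≫ q.hom) (g := q.inv ≫ p.inv)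
    (p.unit ≪≫ whiskerRightIso ((ρ_ _).symm ≪≫ whiskerLeftIso _ q.unit ≪≫ (α_ _ _ _).symm) _ ≪≫
      α_ _ _ _)
    (α_ _ _ _ ≪≫ whiskerLeftIso _ ((α_ _ _ _).symm ≪≫ whiskerRightIso p.counit _ ≪≫ λ_ _) ≪≫
      q.counit), ?_⟩
  change p.hom ≫ q.hom = Φ.app D ≫ Ψ.app D
  rw [hp, hq]
  rfl

end AbstractTilting

theorem mainTheorem3 :
    AbstractTilting.StronglyStablyEquivalent.{w, v, u}
        AbstractTilting.trivalentSource.{w} AbstractTilting.trivalentSink.{w} ∧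
      AbstractTilting.StronglyStablyEquivalent.{w, v, u}
        AbstractTilting.trivalentSource.{w} AbstractTilting.commSquare.{w} ∧
      AbstractTilting.StronglyStablyEquivalent.{w, v, u}
        AbstractTilting.trivalentSink.{w} AbstractTilting.commSquare.{w} := by
  obtain ⟨_, h₁⟩ := AbstractTilting.Vertex.exists_resolves_source.{w, v, u}
  obtain ⟨_, h₂⟩ := AbstractTilting.Vertex.exists_resolves_square.{w, v, u}
  obtain ⟨_, h₃⟩ := AbstractTilting.Vertex.exists_resolves_sink.{w, v, u}
  obtain ⟨_, h₄⟩ := AbstractTilting.Vertex.exists_resolves_square_dual.{w, v, u}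
  -- The source and the sink resolve different shapes, so they are compared through the square,
  -- which resolves both.
  exact ⟨(h₁.stronglyStablyEquivalent h₂).trans (h₄.stronglyStablyEquivalent h₃),
    h₁.stronglyStablyEquivalent h₂, h₃.stronglyStablyEquivalent h₄⟩
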